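/- A pure cubic field is a field $K=\mathbb{Q}(\theta)$ of degree $3$ over $\mathbb{Q}$ with $\theta^3=m$ for some $m\in\mathbb{Z}$. Let $N$ be the Galois closure of such a $K$ over $\mathbb{Q}$ and let $K_2$ be the quadratic subfield of $N$ (here $K_2=\mathbb{Q}(\sqrt{-3})$). Then the conductor of the cyclic cubic extension $N/K_2$ is of the form $\mathfrak{f}(N/K_2)=f(K)\,\mathbb{Z}_{K_2}$ with a positive integer $f(K)$. For every $s\in\mathbb{C}$ with $\operatorname{Re}(s)>1$, $$\sum_{K}\frac{1}{f(K)^s}=-\frac12+\frac16\left(1+\frac{2}{3^s}+\frac{6}{3^{2s}}\right)\prod_{p\ne 3}\left(1+\frac{2}{p^s}\right)+\frac13\prod_{p\equiv\pm1\ (\mathrm{mod}\ 9)}\left(1+\frac{2}{p^s}\right)\prod_{p\not\equiv\pm1\ (\mathrm{mod}\ 9)}\left(1-\frac{1}{p^s}\right),$$ where $K$ runs over the pure cubic fields up to isomorphism, the products are over prime numbers $p$ (and $p\not\equiv\pm1\ (\mathrm{mod}\ 9)$ includes $p=3$), the series converges absolutely, and the products converge unconditionally. -/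

import Mathlib

open NumberField IsDedekindDomain

namespace PureCubic

/-- The `i`-th ramification group (lower numbering, `i ≥ 0`) of the prime `P` of `N` in the
Galois extension `N / F`: the `σ ∈ Gal(N/F)` with `σ x ≡ x (mod P ^ (i + 1))` for every
integer `x` of `N`. -/
def ramificationGroup (F N : Type*) [Field F] [Field N] [Algebra F N]
    (P : HeightOneSpectrum (𝓞 N)) (i : ℕ) : Subgroup (N ≃ₐ[F] N) :=
  (P.asIdeal ^ (i + 1)).inertia (N ≃ₐ[F] N)

open scoped Classical in
/-- The exponent of the conductor of the abelian extension `N / F` at the prime of `F` below `P`: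
`(1 / |G₀|) ∑ |G_i|`, the sum being over the `i ≥ 0` with `G_i ≠ 1`. It is `0` if `P` is unramified;
otherwise it is `φ(t) + 1`, where `t` is the last index with `G_t ≠ 1` and `φ` is Herbrand's
function. This is the Artin conductor exponent of a faithful character of the inertia group when
that group is cyclic; the division is exact by the theorem of Hasse and Arf. If `N / F` is cyclic
of prime degree, it is just the number of `i ≥ 0` with `G_i ≠ 1`. -/
noncomputable def conductorExponent (F N : Type*) [Field F] [Field N] [Algebra F N]
    (P : HeightOneSpectrum (𝓞 N)) : ℕ :=
  (∑ᶠ i : ℕ, if ramificationGroup F N P i = ⊥ then 0 else Nat.card (ramificationGroup F N P i)) /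
    Nat.card (ramificationGroup F N P 0)

/-- The ideal `𝔣` is the (finite part of the) conductor of the abelian extension `N / F` of number
fields: each prime of `F` divides `𝔣` exactly to the power prescribed by the ramification groups of
each of the primes of `N` above it. In particular `𝔣 ≠ 0`, since all multiplicities are finite. -/
def IsConductor (F N : Type*) [Field F] [Field N] [Algebra F N] (𝔣 : Ideal (𝓞 F)) : Prop :=
  ∀ P : HeightOneSpectrum (𝓞 N),
    emultiplicity (P.asIdeal.under (𝓞 F)) 𝔣 = conductorExponent F N P

/-- Let `N` be a Galois number field with a unique quadratic subfield `K₂` (the Galois closure of a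
noncyclic cubic field). The positive integer `f` satisfies `𝔣(N/K₂) = f ℤ_{K₂}`. -/
def IsResolventConductor (N : Type*) [Field N] [Algebra ℚ N] (f : ℕ) : Prop :=
  0 < f ∧ ∃ K₂ : IntermediateField ℚ N, Module.finrank ℚ K₂ = 2 ∧
    IsConductor K₂ N (Ideal.span {(f : 𝓞 K₂)})

/-- A pure cubic field: a cubic field `K = ℚ(θ)` with `θ ^ 3 = m` for some integer `m`. -/
def IsPureCubic (K : Type*) [Field K] [Algebra ℚ K] : Prop :=
  Module.finrank ℚ K = 3 ∧
    ∃ (m : ℤ) (θ : K), θ ^ 3 = (m : K) ∧ IntermediateField.adjoin ℚ {θ} = ⊤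

/-- The pure cubic fields inside a fixed algebraic closure of `ℚ`. -/
abbrev PureCubicField : Type :=
  {K : IntermediateField ℚ (AlgebraicClosure ℚ) // IsPureCubic K}

/-- The Galois closure of `K / ℚ`. -/
noncomputable abbrev galoisClosure (K : Type*) [Field K] [Algebra ℚ K] :
    IntermediateField ℚ (AlgebraicClosure ℚ) :=
  IntermediateField.normalClosure ℚ K (AlgebraicClosure ℚ)

/-- `f` is the positive integer with `𝔣(N/K₂) = f ℤ_{K₂}`, where `N` is the Galois closure of the
noncyclic cubic field `K` and `K₂` is the quadratic subfield of `N`. -/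
def IsCubicConductor (K : Type*) [Field K] [Algebra ℚ K] (f : ℕ) : Prop :=
  IsResolventConductor (galoisClosure K) f

/-- The integer `f(K)` of a noncyclic cubic field `K`. (The set has exactly one element; that it is
nonempty for pure cubic fields is part of the theorem.) -/
noncomputable def cubicConductor (K : Type*) [Field K] [Algebra ℚ K] : ℕ :=
  sInf {f : ℕ | IsCubicConductor K f}

/-- Isomorphism of pure cubic fields. -/
instance isoSetoid : Setoid PureCubicField where
  r K K' := Nonempty (K.1 ≃ₐ[ℚ] K'.1)
  iseqv := ⟨fun _ => ⟨AlgEquiv.refl⟩, fun ⟨e⟩ => ⟨e.symm⟩, fun ⟨e⟩ ⟨e'⟩ => ⟨e.trans e'⟩⟩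

/-- Isomorphism classes of pure cubic fields. -/
abbrev PureCubicClass : Type := Quotient isoSetoid

theorem galoisClosure_le {K K' : Type*} [Field K] [Algebra ℚ K] [Field K'] [Algebra ℚ K']
    (e : K ≃ₐ[ℚ] K') : galoisClosure K ≤ galoisClosure K' := by
  refine iSup_le fun f => ?_
  refine le_trans ?_ (AlgHom.fieldRange_le_normalClosure (f.comp e.symm.toAlgHom))
  rintro _ ⟨x, rfl⟩
  exact ⟨e x, by simp⟩

theorem galoisClosure_congr {K K' : Type*} [Field K] [Algebra ℚ K] [Field K'] [Algebra ℚ K']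
    (e : K ≃ₐ[ℚ] K') : galoisClosure K = galoisClosure K' :=
  le_antisymm (galoisClosure_le e) (galoisClosure_le e.symm)

theorem isCubicConductor_congr {K K' : Type*} [Field K] [Algebra ℚ K] [Field K'] [Algebra ℚ K']
    (e : K ≃ₐ[ℚ] K') (f : ℕ) : IsCubicConductor K f ↔ IsCubicConductor K' f := by
  have key : ∀ N N' : IntermediateField ℚ (AlgebraicClosure ℚ), N = N' →
      (IsResolventConductor N f ↔ IsResolventConductor N' f) := by
    rintro N _ rfl
    rfl
  exact key _ _ (galoisClosure_congr e)

/-- The integer `f(K)` of an isomorphism class of pure cubic fields. -/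
noncomputable def classConductor : PureCubicClass → ℕ :=
  Quotient.lift (fun K : PureCubicField => cubicConductor K.1) (by
    rintro K K' ⟨e⟩
    simp only [cubicConductor, isCubicConductor_congr e])

end PureCubic

/-!
Pure cubic fields correspond to unordered pairs `{a, b}` with `ab` squarefree and
`(a, b) ≠ (1, 1)`, through `K = ℚ(∛(ab²))`. The conductor of the Kummer extension `N / ℚ(ω)`
generated by `∛(ab²)` is found prime by prime, from the valuation of `σ π - π` at a uniformizer `π`
of `N`: it is `ab` if `ab² ≡ ±1 (mod 9)`, and `3ab` otherwise.

The congruence is detected by the characters modulo `9` of order dividing `3`, evaluated at the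
radicand `ab²`. The Dirichlet series over all pairs twisted by such a character has an Euler
product, and each field is counted by two pairs. The summand `-1/2` removes the pair `(1, 1)`.
-/

namespace PureCubic

section Valuation

variable {R : Type*} [CommRing R] (P : HeightOneSpectrum R)

/-- The normalized additive valuation at the prime `P`, with value `⊤` at `0`. -/
noncomputable def val (x : R) : ℕ∞ :=
  emultiplicity P.asIdeal (Ideal.span {x})

theorem val_neg (x : R) : val P (-x) = val P x := by
  rw [val, Ideal.span_singleton_neg, val]

variable [IsDedekindDomain R]

theorem natCast_le_val_iff {n : ℕ} {x : R} : n ≤ val P x ↔ x ∈ P.asIdeal ^ n := by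
  rw [val, ← pow_dvd_iff_le_emultiplicity, Ideal.dvd_span_singleton]

theorem val_eq_zero_iff {x : R} : val P x = 0 ↔ x ∉ P.asIdeal := by
  rw [← not_iff_not, not_not, ← Ne, ← Order.one_le_iff_ne_zero, ← Nat.cast_one (R := ℕ∞),
    natCast_le_val_iff, pow_one]

theorem val_eq_top_iff {x : R} : val P x = ⊤ ↔ x = 0 := by
  rw [val, emultiplicity_eq_top, ← Ideal.span_singleton_eq_bot]
  refine ⟨fun h => not_not.1 fun hx => h (.of_prime_left P.prime hx), ?_⟩
  rintro h hfin
  exact hfin.ne_zero h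

theorem exists_val_eq_natCast {x : R} (hx : x ≠ 0) : ∃ n : ℕ, val P x = n :=
  (ENat.ne_top_iff_exists.1 (mt (val_eq_top_iff P).1 hx)).imp fun _ => Eq.symm

theorem val_of_isUnit {x : R} (hx : IsUnit x) : val P x = 0 :=
  (val_eq_zero_iff P).2 fun h => P.isPrime.ne_top (Ideal.eq_top_of_isUnit_mem _ h hx)

theorem val_mul (x y : R) : val P (x * y) = val P x + val P y := by
  rw [val, ← Ideal.span_singleton_mul_span_singleton, emultiplicity_mul P.prime]
  rfl

theorem val_pow (x : R) (n : ℕ) : val P (x ^ n) = n * val P x := by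
  rw [val, ← Ideal.span_singleton_pow, emultiplicity_pow P.prime]
  rfl

theorem min_le_val_add (x y : R) : min (val P x) (val P y) ≤ val P (x + y) := by
  refine ENat.forall_natCast_le_iff_le.1 fun n hn => ?_
  rw [le_min_iff, natCast_le_val_iff, natCast_le_val_iff] at hn
  exact (natCast_le_val_iff P).2 (add_mem hn.1 hn.2)

theorem val_add_of_lt {x y : R} (h : val P x < val P y) : val P (x + y) = val P x := by
  refine le_antisymm ?_ ((le_min le_rfl h.le).trans (min_le_val_add P x y))
  have hx : min (val P (x + y)) (val P y) ≤ val P x := by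
    simpa [val_neg] using min_le_val_add P (x + y) (-y)
  exact (min_le_iff.1 hx).resolve_right h.not_ge

theorem val_algebraMap {S : Type*} [CommRing S] [IsDedekindDomain S] [Algebra R S]
    [Module.Finite R S] [FaithfulSMul R S] (P : HeightOneSpectrum S) {x : R} (hx : x ≠ 0) :
    val P (algebraMap R S x) = P.asIdeal.ramificationIdx R * val (P.under R) x := by
  have : P.asIdeal.LiesOver (P.under R).asIdeal := ⟨rfl⟩
  rw [val, ← Set.image_singleton, ← Ideal.map_span,
    Ideal.IsDedekindDomain.emultiplicity_map_eq_ramificationIdx'_mul (by simpa using hx)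
      (P.under R).irreducible P.irreducible P.ne_bot,
    Ideal.ramificationIdx'_eq_ramificationIdx _ _ (P.under R).ne_bot]
  rfl

theorem exists_mem_sub_mem_pow {T : Subring R} (hT : ∀ x : R, ∃ c ∈ T, x - c ∈ P.asIdeal) {π : R}
    (hπT : π ∈ T) (hπ : val P π = 1) (x : R) (n : ℕ) : ∃ y ∈ T, x - y ∈ P.asIdeal ^ n := by
  have hval (j : ℕ) : val P (π ^ j) = j := by rw [val_pow, hπ, mul_one]
  induction n with
  | zero => exact ⟨0, zero_mem T, by simp⟩
  | succ n ih =>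
    obtain ⟨y, hyT, hy⟩ := ih
    have hmem : π ^ n ∈ P.asIdeal ^ n := (natCast_le_val_iff P).1 (hval n).ge
    have hnotMem : π ^ n ∉ P.asIdeal ^ (n + 1) := fun h => by
      have := (natCast_le_val_iff P).2 h
      rw [hval, Nat.cast_le] at this
      omega
    obtain ⟨d, e, he, hde⟩ := Ideal.exists_mul_add_mem_pow_succ P.ne_bot _ _ hmem hnotMem hy
    obtain ⟨c, hcT, hc⟩ := hT d
    refine ⟨y + π ^ n * c, add_mem hyT (mul_mem (pow_mem hπT n) hcT), ?_⟩
    rw [show x - (y + π ^ n * c) = π ^ n * (d - c) + e by linear_combination -hde, pow_succ]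
    exact add_mem (Ideal.mul_mem_mul hmem hc) (pow_succ P.asIdeal n ▸ he)

end Valuation

section RamificationGroups

variable {F N : Type*} [Field F] [Field N] [Algebra F N]

theorem smul_algebraMap_ringOfIntegers (τ : N ≃ₐ[F] N) (c : 𝓞 F) :
    τ • algebraMap (𝓞 F) (𝓞 N) c = algebraMap (𝓞 F) (𝓞 N) c :=
  RingOfIntegers.ext (τ.commutes (c : F))

theorem conductorExponent_eq_of_forall [FiniteDimensional F N] [Nontrivial (N ≃ₐ[F] N)]
    {P : HeightOneSpectrum (𝓞 N)} {n : ℕ}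
    (h : ∀ τ : N ≃ₐ[F] N, τ ≠ 1 → ∀ i, τ ∈ ramificationGroup F N P i ↔ i < n) :
    conductorExponent F N P = n := by
  classical
  have htop {i : ℕ} (hi : i < n) : ramificationGroup F N P i = ⊤ :=
    (Subgroup.eq_top_iff' _).2 fun τ =>
      (eq_or_ne τ 1).elim (fun hτ => hτ ▸ one_mem _) fun hτ => (h τ hτ i).2 hi
  have hbot {i : ℕ} (hi : ¬ i < n) : ramificationGroup F N P i = ⊥ :=
    (Subgroup.eq_bot_iff_forall _).2 fun τ hm => not_not.1 fun hτ => hi ((h τ hτ i).1 hm)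
  have hsum : (∑ᶠ i : ℕ, if ramificationGroup F N P i = ⊥ then 0
      else Nat.card (ramificationGroup F N P i)) = n * Nat.card (N ≃ₐ[F] N) := by
    rw [finsum_eq_sum_of_support_subset (s := Finset.range n),
      Finset.sum_congr rfl (g := fun _ => Nat.card (N ≃ₐ[F] N)), Finset.sum_const,
      Finset.card_range, smul_eq_mul]
    · intro i hi
      rw [htop (Finset.mem_range.1 hi), if_neg top_ne_bot, Subgroup.card_top]
    · intro i hi
      by_contra hn
      exact hi (if_pos (hbot (by simpa using hn)))
  rw [conductorExponent]
  refine Eq.trans (congrArg (· / _) (by convert hsum)) ?_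
  rcases Nat.eq_zero_or_pos n with rfl | hn
  · simp
  · rw [htop hn, Subgroup.card_top, Nat.mul_div_cancel _ Nat.card_pos]

theorem conductorExponent_eq_zero [FiniteDimensional F N] [Nontrivial (N ≃ₐ[F] N)]
    {P : HeightOneSpectrum (𝓞 N)}
    (h : ∀ τ : N ≃ₐ[F] N, τ ≠ 1 → ∃ x : 𝓞 N, τ • x - x ∉ P.asIdeal) :
    conductorExponent F N P = 0 := by
  refine conductorExponent_eq_of_forall fun τ hτ i =>
    iff_of_false (fun hm => ?_) (Nat.not_lt_zero i)
  obtain ⟨x, hx⟩ := h τ hτ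
  exact hx (Ideal.pow_le_self i.succ_ne_zero (hm x))

end RamificationGroups

section TotalRamification

variable {F N : Type*} [Field F] [NumberField F] [Field N] [NumberField N] [Algebra F N]
  [IsGalois F N] {P : HeightOneSpectrum (𝓞 N)}

variable (F P) in
theorem ncard_primesOver_mul_ramificationIdx_mul_inertiaDeg :
    (Ideal.primesOver (P.asIdeal.under (𝓞 F)) (𝓞 N)).ncard *
      (P.asIdeal.ramificationIdx (𝓞 F) * P.asIdeal.inertiaDeg (𝓞 F)) = Module.finrank F N := by
  rw [← IsGalois.card_aut_eq_finrank,
    ← Ideal.ncard_primesOver_mul_ramificationIdxIn_mul_inertiaDegIn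
      (P.asIdeal.under (𝓞 F)) (𝓞 N) (N ≃ₐ[F] N),
    Ideal.ramificationIdxIn_eq_ramificationIdx _ P.asIdeal (N ≃ₐ[F] N),
    Ideal.inertiaDegIn_eq_inertiaDeg _ P.asIdeal (N ≃ₐ[F] N)]

theorem ramificationIdx_eq_of_dvd {q : ℕ} (hq : Module.finrank F N = q)
    (h : q ∣ P.asIdeal.ramificationIdx (𝓞 F)) : P.asIdeal.ramificationIdx (𝓞 F) = q := by
  refine Nat.dvd_antisymm ?_ h
  rw [← hq, ← ncard_primesOver_mul_ramificationIdx_mul_inertiaDeg F P]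
  exact dvd_mul_of_dvd_right (dvd_mul_right _ _) _

theorem ncard_primesOver_mul_inertiaDeg_eq_one
    (he : P.asIdeal.ramificationIdx (𝓞 F) = Module.finrank F N) :
    (Ideal.primesOver (P.asIdeal.under (𝓞 F)) (𝓞 N)).ncard * P.asIdeal.inertiaDeg (𝓞 F) = 1 := by
  have h := ncard_primesOver_mul_ramificationIdx_mul_inertiaDeg F P
  rw [he, mul_left_comm] at h
  exact (Nat.mul_eq_left Module.finrank_pos.ne').1 h

open Pointwise in
theorem smul_mem_asIdeal_pow (he : P.asIdeal.ramificationIdx (𝓞 F) = Module.finrank F N)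
    (τ : N ≃ₐ[F] N) {x : 𝓞 N} {k : ℕ} (hx : x ∈ P.asIdeal ^ k) : τ • x ∈ P.asIdeal ^ k := by
  obtain ⟨Q, hQ⟩ := Set.ncard_eq_one.1
    (Nat.eq_one_of_mul_eq_one_right (ncard_primesOver_mul_inertiaDeg_eq_one he))
  have hP : P.asIdeal ∈ Ideal.primesOver (P.asIdeal.under (𝓞 F)) (𝓞 N) := ⟨P.isPrime, ⟨rfl⟩⟩
  have hτP : τ • P.asIdeal ∈ Ideal.primesOver (P.asIdeal.under (𝓞 F)) (𝓞 N) :=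
    ⟨inferInstance, inferInstance⟩
  have heq : τ • P.asIdeal = P.asIdeal := by
    rw [hQ, Set.mem_singleton_iff] at hP hτP
    rw [hτP, hP]
  rw [← heq, ← smul_pow']
  exact Ideal.smul_mem_pointwise_smul τ x _ hx

theorem exists_sub_algebraMap_mem (he : P.asIdeal.ramificationIdx (𝓞 F) = Module.finrank F N)
    (x : 𝓞 N) : ∃ c : 𝓞 F, x - algebraMap (𝓞 F) (𝓞 N) c ∈ P.asIdeal := by
  have := (P.under (𝓞 F)).isMaximal
  have : P.asIdeal.IsMaximal := P.isMaximal
  let := Ideal.Quotient.field (P.asIdeal.under (𝓞 F))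
  have hf := Nat.eq_one_of_mul_eq_one_left (ncard_primesOver_mul_inertiaDeg_eq_one he)
  rw [Ideal.inertiaDeg_eq_of_isMaximal (P.asIdeal.under (𝓞 F)) P.asIdeal] at hf
  obtain ⟨c, hc⟩ := (finrank_eq_one_iff_of_nonzero' (1 : 𝓞 N ⧸ P.asIdeal) one_ne_zero).1 hf
    (Ideal.Quotient.mk _ x)
  obtain ⟨c, rfl⟩ := Ideal.Quotient.mk_surjective c
  refine ⟨c, ?_⟩
  rw [← Ideal.Quotient.eq, ← hc, Algebra.smul_def, mul_one]
  rfl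

theorem mem_ramificationGroup_iff (he : P.asIdeal.ramificationIdx (𝓞 F) = Module.finrank F N)
    {π : 𝓞 N} (hπ : val P π = 1) {τ : N ≃ₐ[F] N} {i : ℕ} :
    τ ∈ ramificationGroup F N P i ↔ τ • π - π ∈ P.asIdeal ^ (i + 1) := by
  refine ⟨fun h => h π, fun h x => ?_⟩
  let T : Subring (𝓞 N) := RingHom.eqLocus
    ((Ideal.Quotient.mk (P.asIdeal ^ (i + 1))).comp (MulSemiringAction.toRingHom _ (𝓞 N) τ))
    (Ideal.Quotient.mk (P.asIdeal ^ (i + 1)))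
  have mem_T {y : 𝓞 N} : y ∈ T ↔ τ • y - y ∈ P.asIdeal ^ (i + 1) := Ideal.Quotient.eq
  have hT (x : 𝓞 N) : ∃ c ∈ T, x - c ∈ P.asIdeal := by
    obtain ⟨c, hc⟩ := exists_sub_algebraMap_mem he x
    refine ⟨_, mem_T.2 ?_, hc⟩
    rw [smul_algebraMap_ringOfIntegers, sub_self]
    exact zero_mem _
  obtain ⟨y, hy, hxy⟩ := exists_mem_sub_mem_pow P hT (mem_T.2 h) hπ x (i + 1)
  change τ • x - x ∈ P.asIdeal ^ (i + 1)
  rw [show τ • x - x = τ • (x - y) - (x - y) + (τ • y - y) by rw [smul_sub]; ring]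
  exact add_mem (sub_mem (smul_mem_asIdeal_pow he τ hxy) hxy) (mem_T.1 hy)

theorem conductorExponent_eq_of_val_smul_sub_eq [Nontrivial (N ≃ₐ[F] N)]
    (he : P.asIdeal.ramificationIdx (𝓞 F) = Module.finrank F N) {n : ℕ}
    (h : ∀ τ : N ≃ₐ[F] N, τ ≠ 1 → ∃ π : 𝓞 N, val P π = 1 ∧ val P (τ • π - π) = n) :
    conductorExponent F N P = n := by
  refine conductorExponent_eq_of_forall fun τ hτ i => ?_
  obtain ⟨π, hπ, hn⟩ := h τ hτ
  rw [mem_ramificationGroup_iff he hπ, ← natCast_le_val_iff, hn, Nat.cast_le, Nat.succ_le_iff]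

end TotalRamification

section ResidueCharacteristic

theorem intCast_mem_iff_dvd {R : Type*} [CommRing R] {I : Ideal R} (hI : I ≠ ⊤) {p : ℕ}
    (hp : p.Prime) (h : (p : R) ∈ I) {n : ℤ} : (n : R) ∈ I ↔ (p : ℤ) ∣ n := by
  constructor
  · intro hn
    by_contra hd
    obtain ⟨a, b, hab⟩ := (Nat.prime_iff_prime_int.1 hp).coprime_iff_not_dvd.2 hd
    refine hI ((Ideal.eq_top_iff_one I).2 ?_)
    have hone : (a : R) * p + b * n = 1 := by exact_mod_cast congrArg (Int.cast : ℤ → R) hab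
    exact hone ▸ add_mem (I.mul_mem_left _ h) (I.mul_mem_left _ hn)
  · rintro ⟨k, rfl⟩
    rw [Int.cast_mul, Int.cast_natCast]
    exact I.mul_mem_right _ h

theorem natCast_mem_iff_dvd {R : Type*} [CommRing R] {I : Ideal R} (hI : I ≠ ⊤) {p : ℕ}
    (hp : p.Prime) (h : (p : R) ∈ I) {n : ℕ} : (n : R) ∈ I ↔ p ∣ n := by
  exact_mod_cast intCast_mem_iff_dvd hI hp h (n := n)

theorem under_int_eq_span {R : Type*} [CommRing R] {I : Ideal R} (hI : I ≠ ⊤) {p : ℕ}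
    (hp : p.Prime) (h : (p : R) ∈ I) : I.under ℤ = Ideal.span {(p : ℤ)} := by
  ext n
  rw [Ideal.mem_span_singleton, ← intCast_mem_iff_dvd hI hp h]
  rfl

theorem natCast_mem_under_iff {R S : Type*} [CommRing R] [CommRing S] [Algebra R S] {I : Ideal S}
    {n : ℕ} : (n : R) ∈ I.under R ↔ (n : S) ∈ I := by
  rw [Ideal.under_def, Ideal.mem_comap, map_natCast]

variable {N : Type*} [Field N] [NumberField N] {P : HeightOneSpectrum (𝓞 N)}

theorem val_natCast_of_not_dvd {p n : ℕ} (hp : p.Prime) (h : (p : 𝓞 N) ∈ P.asIdeal)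
    (hn : ¬ p ∣ n) : val P (n : 𝓞 N) = 0 :=
  (val_eq_zero_iff P).2 (mt (natCast_mem_iff_dvd P.isPrime.ne_top hp h).1 hn)

theorem val_natCast_self {p : ℕ} (hp : p.Prime) (h : (p : 𝓞 N) ∈ P.asIdeal) :
    val P (p : 𝓞 N) = P.asIdeal.ramificationIdx ℤ := by
  have hself : val (P.under ℤ) (p : ℤ) = 1 := by
    change emultiplicity (P.asIdeal.under ℤ) _ = 1
    rw [under_int_eq_span P.isPrime.ne_top hp h]
    have hprime : Prime (Ideal.span {(p : ℤ)}) :=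
      Ideal.prime_span_singleton_iff.2 (Nat.prime_iff_prime_int.1 hp)
    exact (FiniteMultiplicity.of_prime_left hprime hprime.ne_zero).emultiplicity_self
  have hmap := val_algebraMap (R := ℤ) P (Nat.cast_ne_zero.2 hp.ne_zero)
  rwa [hself, mul_one, map_natCast] at hmap

end ResidueCharacteristic

section Eisenstein

variable {F : Type*} [Field F] [NumberField F] [IsCyclotomicExtension {3} ℚ F]

variable (F) in
theorem exists_sq_add_add_one_eq_zero : ∃ z : 𝓞 F, z ^ 2 + z + 1 = 0 := by
  have hζ := (IsCyclotomicExtension.zeta_spec 3 ℚ F).toInteger_isPrimitiveRoot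
  have hsum := hζ.geom_sum_eq_zero (by norm_num)
  simp only [Finset.sum_range_succ, Finset.sum_range_zero, pow_zero, pow_one] at hsum
  exact ⟨_, by linear_combination hsum⟩

theorem val_natCast_eq_one {P : HeightOneSpectrum (𝓞 F)} {p : ℕ} (hp : p.Prime) (hp3 : p ≠ 3)
    (h : (p : 𝓞 F) ∈ P.asIdeal) : val P (p : 𝓞 F) = 1 := by
  have := Fact.mk hp
  have : P.asIdeal.LiesOver (Ideal.span {(p : ℤ)}) :=
    ⟨(under_int_eq_span P.isPrime.ne_top hp h).symm⟩
  rw [val_natCast_self hp h, IsCyclotomicExtension.Rat.ramificationIdx_eq_of_not_dvd (m := 3) p F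
    P.asIdeal (mt (Nat.prime_dvd_prime_iff_eq hp Nat.prime_three).1 hp3), Nat.cast_one]

theorem val_three_eq_two {P : HeightOneSpectrum (𝓞 F)} (h : (3 : 𝓞 F) ∈ P.asIdeal) :
    val P (3 : 𝓞 F) = 2 := by
  have := Fact.mk Nat.prime_three
  have h' : ((3 : ℕ) : 𝓞 F) ∈ P.asIdeal := by exact_mod_cast h
  have : P.asIdeal.LiesOver (Ideal.span {((3 : ℕ) : ℤ)}) :=
    ⟨(under_int_eq_span P.isPrime.ne_top Nat.prime_three h').symm⟩
  have hval := val_natCast_self Nat.prime_three h'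
  rwa [IsCyclotomicExtension.Rat.ramificationIdx_eq_of_prime 3 F P.asIdeal, Nat.cast_ofNat] at hval

variable {N : Type*} [Field N] [NumberField N] [Algebra F N] {P : HeightOneSpectrum (𝓞 N)}

variable (F) in
theorem val_natCast_eq_ramificationIdx {p : ℕ} (hp : p.Prime) (hp3 : p ≠ 3)
    (h : (p : 𝓞 N) ∈ P.asIdeal) : val P (p : 𝓞 N) = P.asIdeal.ramificationIdx (𝓞 F) := by
  have hval := val_algebraMap (R := 𝓞 F) P (Nat.cast_ne_zero.2 hp.ne_zero)
  have h' : (p : 𝓞 F) ∈ (P.under (𝓞 F)).asIdeal := natCast_mem_under_iff.2 h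
  rwa [val_natCast_eq_one hp hp3 h', mul_one, map_natCast] at hval

variable (F) in
theorem val_three_eq_two_mul_ramificationIdx (h : (3 : 𝓞 N) ∈ P.asIdeal) :
    val P (3 : 𝓞 N) = 2 * P.asIdeal.ramificationIdx (𝓞 F) := by
  have h' : (3 : 𝓞 F) ∈ (P.under (𝓞 F)).asIdeal := by
    change algebraMap (𝓞 F) (𝓞 N) 3 ∈ P.asIdeal
    rwa [map_ofNat (algebraMap (𝓞 F) (𝓞 N)) 3]
  have hval := val_algebraMap P (x := (3 : 𝓞 F)) (by norm_num)
  rwa [val_three_eq_two h', mul_comm, map_ofNat (algebraMap (𝓞 F) (𝓞 N)) 3] at hval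

end Eisenstein

section Kummer

theorem isUnit_of_sq_add_add_one_eq_zero {R : Type*} [CommRing R] {w : R}
    (hw : w ^ 2 + w + 1 = 0) : IsUnit w :=
  IsUnit.of_mul_eq_one (-w - 1) (by linear_combination -hw)

theorem sub_one_dvd_three {R : Type*} [CommRing R] {w : R} (hw : w ^ 2 + w + 1 = 0) :
    w - 1 ∣ 3 :=
  ⟨-2 - w, by linear_combination hw⟩

theorem val_sub_one_eq_of_val_three_eq {R : Type*} [CommRing R] [IsDedekindDomain R]
    {P : HeightOneSpectrum R} {w : R} (hw : w ^ 2 + w + 1 = 0) {n : ℕ∞} (h3 : val P 3 = 2 * n) :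
    val P (w - 1) = n := by
  have hsq : (w - 1) ^ 2 = -(w * 3) := by linear_combination hw
  have hval := congrArg (val P) hsq
  rw [val_pow, val_neg, val_mul, val_of_isUnit P (isUnit_of_sq_add_add_one_eq_zero hw),
    zero_add, h3, Nat.cast_ofNat] at hval
  exact (ENat.mul_right_strictMono two_ne_zero (by decide)).injective hval

open Polynomial in
theorem sub_one_dvd_sub_one_of_pow_three_eq {R : Type*} [CommRing R] [IsDomain R]
    [IsIntegrallyClosed R] {w θ u : R} (hw : w ^ 2 + w + 1 = 0) (h : θ ^ 3 = 1 + 9 * u) :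
    w - 1 ∣ θ - 1 := by
  rcases eq_or_ne (w - 1) 0 with hw0 | hw0
  · have hθ : (θ - 1) ^ 3 = 0 := by
      linear_combination h + (3 * u - θ ^ 2 + θ) * (hw - (w + 2) * hw0)
    rw [eq_zero_of_pow_eq_zero hθ]
    exact dvd_zero _
  let K := FractionRing R
  have hw0' : algebraMap R K w - 1 ≠ 0 := by
    rwa [← map_one (algebraMap R K), ← map_sub, Ne, FaithfulSMul.algebraMap_eq_zero_iff]
  obtain ⟨b, hb⟩ : ∃ b, algebraMap R K θ - 1 = (algebraMap R K w - 1) * b :=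
    ⟨_, (mul_div_cancel₀ _ hw0').symm⟩
  let p : R[X] := X ^ 3 - (C (w ^ 2 * (w - 1)) * X ^ 2 + C (w ^ 2) * X + C (w * (w - 1) * u))
  have hb_int : IsIntegral R b := by
    refine ⟨p, monic_X_pow_sub (n := 3) degree_quadratic_lt, ?_⟩
    have hwK := congrArg (algebraMap R K) hw
    have hK := congrArg (algebraMap R K) h
    simp only [p, eval₂_sub, eval₂_add, eval₂_mul, eval₂_X_pow, eval₂_C, eval₂_X]
    simp only [map_mul, map_pow, map_sub, map_add, map_one, map_zero,
      map_ofNat (algebraMap R K) 9, eq_add_of_sub_eq hb] at hwK hK ⊢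
    generalize algebraMap R K w = v at *
    refine mul_left_cancel₀ (pow_ne_zero 3 hw0') ?_
    linear_combination hK + ((v - 1) ^ 2 * b ^ 2 + (v - 1) * b) * (-v ^ 2 + 3 * v - 3) * hwK +
      algebraMap R K u * (-v * (v ^ 2 + v + 1) + 6 * v ^ 2 - 9 * v + 9) * hwK
  obtain ⟨c, rfl⟩ := IsIntegrallyClosed.isIntegral_iff.1 hb_int
  refine ⟨c, FaithfulSMul.algebraMap_injective R K ?_⟩
  simpa using hb

/-- Every nontrivial automorphism of `N / F` multiplies `α` by a primitive cube root of unity: the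
integer `α` is a Kummer generator of the cyclic cubic extension `N / F`. -/
def IsKummerGenerator (F : Type*) {N : Type*} [Field F] [Field N] [Algebra F N] (α : 𝓞 N) : Prop :=
  ∀ τ : N ≃ₐ[F] N, τ ≠ 1 →
    ∃ z : 𝓞 F, z ^ 2 + z + 1 = 0 ∧ τ • α = algebraMap (𝓞 F) (𝓞 N) z * α

variable {F N : Type*} [Field F] [Field N] [Algebra F N]

theorem IsKummerGenerator.exists_smul_eq {α : 𝓞 N} (hα : IsKummerGenerator F α)
    {τ : N ≃ₐ[F] N} (hτ : τ ≠ 1) :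
    ∃ w : 𝓞 N, w ^ 2 + w + 1 = 0 ∧ τ • w = w ∧ τ • α = w * α := by
  obtain ⟨z, hz, hτα⟩ := hα τ hτ
  exact ⟨_, by simpa using congrArg (algebraMap (𝓞 F) (𝓞 N)) hz,
    smul_algebraMap_ringOfIntegers τ z, hτα⟩

theorem three_mul_smul_sub_eq {τ : N ≃ₐ[F] N} {w α π : 𝓞 N} (hτw : τ • w = w)
    (hπ : (w - 1) * α ^ 2 = 3 * π) : 3 * (τ • π - π) = (w - 1) * ((τ • α) ^ 2 - α ^ 2) := by
  have hsmul := congrArg (MulSemiringAction.toRingHom _ (𝓞 N) τ) hπ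
  simp only [map_mul, map_pow, map_sub, map_one, map_ofNat,
    MulSemiringAction.toRingHom_apply, hτw] at hsmul
  linear_combination hπ - hsmul

theorem smul_sub_eq_of_smul_eq [CharZero N] {τ : N ≃ₐ[F] N} {w α π : 𝓞 N}
    (hw : w ^ 2 + w + 1 = 0) (hτw : τ • w = w) (hτα : τ • α = w * α)
    (hπ : (w - 1) * α ^ 2 = 3 * π) : τ • π - π = -w ^ 2 * ((w - 1) * π) := by
  refine mul_left_cancel₀ (show (3 : 𝓞 N) ≠ 0 by norm_num) ?_
  rw [three_mul_smul_sub_eq hτw hπ, hτα]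
  linear_combination -w ^ 2 * (w - 1) * hπ + (w - 1) ^ 2 * α ^ 2 * hw

theorem smul_sub_eq_of_smul_add_one_eq [CharZero N] {τ : N ≃ₐ[F] N} {w α π : 𝓞 N}
    (hw : w ^ 2 + w + 1 = 0) (hτw : τ • w = w) (hτα : τ • (α + 1) = w * (α + 1))
    (hπ : (w - 1) * α ^ 2 = 3 * π) :
    τ • π - π = -w * ((α + 1) * (2 * α + (w - 1) * (α + 1))) := by
  refine mul_left_cancel₀ (show (3 : 𝓞 N) ≠ 0 by norm_num) ?_
  rw [smul_add, smul_one] at hτα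
  rw [three_mul_smul_sub_eq hτw hπ, eq_sub_of_add_eq hτα]
  linear_combination (α + 1) * (2 * α + (w - 1) * (α + 1)) * hw

theorem conductorExponent_eq_zero_of_notMem [FiniteDimensional F N] [Nontrivial (N ≃ₐ[F] N)]
    {α : 𝓞 N} (hα : IsKummerGenerator F α) {P : HeightOneSpectrum (𝓞 N)}
    (h3 : (3 : 𝓞 N) ∉ P.asIdeal) (hαP : α ∉ P.asIdeal) : conductorExponent F N P = 0 := by
  refine conductorExponent_eq_zero fun τ hτ => ⟨α, fun hmem => ?_⟩
  obtain ⟨w, hw, -, hτα⟩ := hα.exists_smul_eq hτ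
  rw [hτα, ← sub_one_mul] at hmem
  exact h3 (P.asIdeal.mem_of_dvd (sub_one_dvd_three hw)
    ((P.isPrime.mem_or_mem hmem).resolve_right hαP))

theorem conductorExponent_eq_zero_of_pow_three_eq [NumberField N] [FiniteDimensional F N]
    [Nontrivial (N ≃ₐ[F] N)] {θ : 𝓞 N} (hθ : IsKummerGenerator F θ) {u : ℤ}
    (h : θ ^ 3 = 1 + 9 * u) {P : HeightOneSpectrum (𝓞 N)} (hP : (3 : 𝓞 N) ∈ P.asIdeal) :
    conductorExponent F N P = 0 := by
  refine conductorExponent_eq_zero fun τ hτ => ?_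
  obtain ⟨w, hw, hτw, hτθ⟩ := hθ.exists_smul_eq hτ
  have hw0 : w - 1 ≠ 0 := by
    intro h0
    have h3 : (3 : 𝓞 N) = 0 := zero_dvd_iff.1 (h0 ▸ sub_one_dvd_three hw)
    norm_num at h3
  obtain ⟨β, hβ⟩ := sub_one_dvd_sub_one_of_pow_three_eq hw h
  have hτβ : τ • β - β = θ := by
    have hsmul := congrArg (τ • ·) hβ
    simp only [smul_mul', smul_sub, smul_one, hτθ, hτw] at hsmul
    exact mul_left_cancel₀ hw0 (by linear_combination hβ - hsmul)
  refine ⟨β, hτβ ▸ fun hθP => P.isPrime.ne_top ((Ideal.eq_top_iff_one _).2 ?_)⟩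
  rw [show (1 : 𝓞 N) = θ ^ 2 * θ - 3 * (u * 3) by linear_combination -h]
  exact sub_mem (Ideal.mul_mem_left _ _ hθP) (Ideal.mul_mem_right _ _ hP)

variable [NumberField F] [IsCyclotomicExtension {3} ℚ F] [NumberField N] [IsGalois F N]
  {P : HeightOneSpectrum (𝓞 N)}

theorem conductorExponent_eq_one [Nontrivial (N ≃ₐ[F] N)] (hd : Module.finrank F N = 3)
    {α β : 𝓞 N} (hα : IsKummerGenerator F α) {p : ℕ} (hp : p.Prime) (hp3 : p ≠ 3)
    (hβ : β ∉ P.asIdeal) (h : α ^ 3 = p * β) (hP : (p : 𝓞 N) ∈ P.asIdeal) :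
    conductorExponent F N P = 1 := by
  have h3 : (3 : 𝓞 N) ∉ P.asIdeal := by
    have := mt (natCast_mem_iff_dvd P.isPrime.ne_top hp hP (n := 3)).1
      (mt (Nat.prime_dvd_prime_iff_eq hp Nat.prime_three).1 hp3)
    exact_mod_cast this
  have hval : 3 * val P α = P.asIdeal.ramificationIdx (𝓞 F) := by
    rw [← val_natCast_eq_ramificationIdx F hp hp3 hP, ← add_zero (val P (p : 𝓞 N)),
      ← (val_eq_zero_iff P).2 hβ, ← val_mul, ← h, val_pow, Nat.cast_ofNat]
  obtain ⟨k, hk⟩ := exists_val_eq_natCast P (x := α) (by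
    rintro rfl
    rw [(val_eq_top_iff P).2 rfl] at hval
    exact ENat.natCast_ne_top _ (hval.symm.trans (by norm_num)))
  have hk' : 3 * k = P.asIdeal.ramificationIdx (𝓞 F) := by rw [hk] at hval; exact_mod_cast hval
  have he := ramificationIdx_eq_of_dvd hd ⟨k, hk'.symm⟩
  obtain rfl : k = 1 := by omega
  refine conductorExponent_eq_of_val_smul_sub_eq (he.trans hd.symm) fun τ hτ => ⟨α, hk, ?_⟩
  obtain ⟨w, hw, -, hτα⟩ := hα.exists_smul_eq hτ
  have hw1 : val P (w - 1) = 0 :=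
    (val_eq_zero_iff P).2 fun hw1 => h3 (P.asIdeal.mem_of_dvd (sub_one_dvd_three hw) hw1)
  rw [hτα, ← sub_one_mul, val_mul, hw1, hk, zero_add]

theorem ramificationIdx_eq_three_and_val_eq_two (hd : Module.finrank F N = 3) {α β : 𝓞 N}
    (hβ : β ∉ P.asIdeal) (h : α ^ 3 = 3 * β) (hP : (3 : 𝓞 N) ∈ P.asIdeal) :
    P.asIdeal.ramificationIdx (𝓞 F) = 3 ∧ val P α = 2 := by
  have hval : 3 * val P α = 2 * P.asIdeal.ramificationIdx (𝓞 F) := by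
    rw [← val_three_eq_two_mul_ramificationIdx F hP, ← add_zero (val P (3 : 𝓞 N)),
      ← (val_eq_zero_iff P).2 hβ, ← val_mul, ← h, val_pow, Nat.cast_ofNat]
  obtain ⟨k, hk⟩ := exists_val_eq_natCast P (x := α) (by
    rintro rfl
    rw [(val_eq_top_iff P).2 rfl] at hval
    exact ENat.natCast_ne_top (2 * _) (by exact_mod_cast hval.symm.trans (by norm_num)))
  have hk' : 3 * k = 2 * P.asIdeal.ramificationIdx (𝓞 F) := by rw [hk] at hval; exact_mod_cast hval
  have he := ramificationIdx_eq_of_dvd (P := P) hd (by omega)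
  obtain rfl : k = 2 := by omega
  exact ⟨he, hk⟩

theorem exists_three_mul_eq_and_val_eq_one (h3 : val P 3 = 2 * 3) {α β w : 𝓞 N}
    (hα : val P α = 2) (h : α ^ 3 = 3 * β) (hw : w ^ 2 + w + 1 = 0) :
    ∃ π : 𝓞 N, (w - 1) * α ^ 2 = 3 * π ∧ val P π = 1 := by
  have hdvd : (3 : 𝓞 N) ^ 3 ∣ ((w - 1) * α ^ 2) ^ 3 := by
    refine ⟨-w * (w - 1) * β ^ 2, ?_⟩
    linear_combination (w - 1) ^ 3 * (α ^ 3 + 3 * β) * h + 9 * β ^ 2 * (w - 1) * hw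
  obtain ⟨π, hπ⟩ := (IsIntegrallyClosed.pow_dvd_pow_iff three_ne_zero).1 hdvd
  refine ⟨π, hπ, ENat.add_right_injective_of_ne_top (n := 6) (by decide) ?_⟩
  have hval := congrArg (val P) hπ
  rw [val_mul, val_mul, val_pow, val_sub_one_eq_of_val_three_eq hw h3, hα, h3] at hval
  exact hval.symm

theorem conductorExponent_eq_four [Nontrivial (N ≃ₐ[F] N)] (hd : Module.finrank F N = 3)
    {α β : 𝓞 N} (hα : IsKummerGenerator F α) (hβ : β ∉ P.asIdeal) (h : α ^ 3 = 3 * β)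
    (hP : (3 : 𝓞 N) ∈ P.asIdeal) : conductorExponent F N P = 4 := by
  obtain ⟨he, hvα⟩ := ramificationIdx_eq_three_and_val_eq_two (F := F) hd hβ h hP
  have h3 := val_three_eq_two_mul_ramificationIdx F hP
  rw [he, Nat.cast_ofNat] at h3
  refine conductorExponent_eq_of_val_smul_sub_eq (he.trans hd.symm) fun τ hτ => ?_
  obtain ⟨w, hw, hτw, hτα⟩ := hα.exists_smul_eq hτ
  obtain ⟨π, hπ, hvπ⟩ := exists_three_mul_eq_and_val_eq_one h3 hvα h hw
  have hw0 := (isUnit_of_sq_add_add_one_eq_zero hw).pow 2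
  refine ⟨π, hvπ, ?_⟩
  rw [smul_sub_eq_of_smul_eq hw hτw hτα hπ, val_mul, val_mul, hvπ,
    val_of_isUnit P hw0.neg, val_sub_one_eq_of_val_three_eq hw h3]
  norm_num

theorem conductorExponent_eq_two [Nontrivial (N ≃ₐ[F] N)] (hd : Module.finrank F N = 3)
    {θ : 𝓞 N} (hθ : IsKummerGenerator F θ) {u : ℤ} (hu : ¬ 3 ∣ u) (h : θ ^ 3 = 1 + 3 * u)
    (hP : (3 : 𝓞 N) ∈ P.asIdeal) : conductorExponent F N P = 2 := by
  obtain ⟨α, rfl⟩ : ∃ α, θ = α + 1 := ⟨θ - 1, (sub_add_cancel θ 1).symm⟩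
  have hα3 : α ^ 3 = 3 * (u - α - α ^ 2) := by linear_combination h
  have hαP : α ∈ P.asIdeal := P.isPrime.mem_of_pow_mem 3 (hα3 ▸ Ideal.mul_mem_right _ _ hP)
  have hβ : (u : 𝓞 N) - α - α ^ 2 ∉ P.asIdeal := fun hmem => by
    refine hu ((intCast_mem_iff_dvd P.isPrime.ne_top Nat.prime_three (by exact_mod_cast hP)).1 ?_)
    rw [show (u : 𝓞 N) = u - α - α ^ 2 + α * (1 + α) by ring]
    exact add_mem hmem (Ideal.mul_mem_right _ _ hαP)
  obtain ⟨he, hvα⟩ := ramificationIdx_eq_three_and_val_eq_two (F := F) hd hβ hα3 hP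
  have h3 := val_three_eq_two_mul_ramificationIdx F hP
  rw [he, Nat.cast_ofNat] at h3
  refine conductorExponent_eq_of_val_smul_sub_eq (he.trans hd.symm) fun τ hτ => ?_
  obtain ⟨w, hw, hτw, hτθ⟩ := hθ.exists_smul_eq hτ
  obtain ⟨π, hπ, hvπ⟩ := exists_three_mul_eq_and_val_eq_one h3 hvα hα3 hw
  have hv1 : val P (α + 1) = 0 := (val_eq_zero_iff P).2 fun hmem =>
    P.isPrime.ne_top ((Ideal.eq_top_iff_one _).2 (by simpa using sub_mem hmem hαP))
  have hv2 : val P (2 : 𝓞 N) = 0 := by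
    exact_mod_cast val_natCast_of_not_dvd (n := 2) Nat.prime_three (by exact_mod_cast hP)
      (by norm_num)
  have hv2α : val P (2 * α) = 2 := by rw [val_mul, hv2, hvα, zero_add]
  have hlt : val P (2 * α) < val P ((w - 1) * (α + 1)) := by
    rw [hv2α, val_mul, val_sub_one_eq_of_val_three_eq hw h3, hv1]
    norm_num
  refine ⟨π, hvπ, ?_⟩
  rw [smul_sub_eq_of_smul_add_one_eq hw hτw hτθ hπ, val_mul, val_mul, val_add_of_lt P hlt, hv2α,
    hv1, val_of_isUnit P (isUnit_of_sq_add_add_one_eq_zero hw).neg]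
  norm_num

end Kummer

section KummerGenerators

theorem eq_or_eq_mul_of_pow_three_eq {R : Type*} [CommRing R] [IsDomain R] {w x y : R}
    (hw : w ^ 2 + w + 1 = 0) (h : x ^ 3 = y ^ 3) : x = y ∨ x = w * y ∨ x = w ^ 2 * y := by
  have hmul : (x - y) * ((x - w * y) * (x - w ^ 2 * y)) = 0 := by
    linear_combination h + (-x ^ 2 * y + w * x * y ^ 2 - (w - 1) * y ^ 3) * hw
  simpa only [mul_eq_zero, sub_eq_zero] using hmul

theorem sq_sq_add_sq_add_one_eq_zero {R : Type*} [CommRing R] {w : R} (hw : w ^ 2 + w + 1 = 0) :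
    (w ^ 2) ^ 2 + w ^ 2 + 1 = 0 := by
  linear_combination (w ^ 2 - w + 1) * hw

variable {F N : Type*} [Field F] [Field N] [Algebra F N] {α β : 𝓞 N}

theorem isKummerGenerator_of_pow_three_eq [Algebra.IsAlgebraic F N] {z c : 𝓞 F}
    (hz : z ^ 2 + z + 1 = 0) (h : α ^ 3 = algebraMap (𝓞 F) (𝓞 N) c)
    (htop : IntermediateField.adjoin F {(α : N)} = ⊤) : IsKummerGenerator F α := by
  intro τ hτ
  have hw := congrArg (algebraMap (𝓞 F) (𝓞 N)) hz
  simp only [map_add, map_pow, map_one, map_zero] at hw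
  have hcube : (τ • α) ^ 3 = α ^ 3 := by
    rw [← smul_pow', h, smul_algebraMap_ringOfIntegers]
  rcases eq_or_eq_mul_of_pow_three_eq hw hcube with hτα | hτα | hτα
  · refine absurd (AlgEquiv.coe_toAlgHom_injective (AlgHom.ext_of_adjoin_eq_top
      (IntermediateField.adjoin_eq_top_iff.1 htop) ?_)) hτ
    rintro _ rfl
    exact congrArg (algebraMap (𝓞 N) N) hτα
  · exact ⟨z, hz, hτα⟩
  · exact ⟨z ^ 2, sq_sq_add_sq_add_one_eq_zero hz, by rw [hτα, map_pow]⟩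

theorem IsKummerGenerator.neg (hα : IsKummerGenerator F α) : IsKummerGenerator F (-α) := by
  intro τ hτ
  obtain ⟨z, hz, hτα⟩ := hα τ hτ
  exact ⟨z, hz, by rw [smul_neg, hτα, mul_neg]⟩

theorem IsKummerGenerator.of_mul_eq_sq (hα : IsKummerGenerator F α) {c : 𝓞 F}
    (hc : algebraMap (𝓞 F) (𝓞 N) c ≠ 0) (h : algebraMap (𝓞 F) (𝓞 N) c * β = α ^ 2) :
    IsKummerGenerator F β := by
  intro τ hτ
  obtain ⟨z, hz, hτα⟩ := hα τ hτ
  refine ⟨z ^ 2, sq_sq_add_sq_add_one_eq_zero hz, mul_left_cancel₀ hc ?_⟩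
  have hsmul := congrArg (τ • ·) h
  simp only [smul_mul', smul_pow', hτα, smul_algebraMap_ringOfIntegers] at hsmul
  rw [map_pow]
  linear_combination hsmul - algebraMap (𝓞 F) (𝓞 N) z ^ 2 * h

theorem IsKummerGenerator.exists_pow_three_eq [NumberField N] (hα : IsKummerGenerator F α)
    {a b : ℕ} (hb : b ≠ 0) (h : α ^ 3 = a * b ^ 2) :
    ∃ β : 𝓞 N, IsKummerGenerator F β ∧ β ^ 3 = b * a ^ 2 := by
  have hb0 : (b : 𝓞 N) ≠ 0 := Nat.cast_ne_zero.2 hb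
  have hsq : (α ^ 2) ^ 3 = (b : 𝓞 N) ^ 3 * (b * a ^ 2) := by
    linear_combination (α ^ 3 + a * b ^ 2) * h
  obtain ⟨β, hβ⟩ := (IsIntegrallyClosed.pow_dvd_pow_iff three_ne_zero).1 ⟨_, hsq⟩
  refine ⟨β, hα.of_mul_eq_sq (c := b) (by simpa using hb) (by simpa using hβ.symm), ?_⟩
  exact mul_left_cancel₀ (pow_ne_zero 3 hb0) (by rw [← mul_pow, ← hβ, hsq])

theorem prime_dvd_mul_sq_iff {p a b : ℕ} (hp : p.Prime) : p ∣ a * b ^ 2 ↔ p ∣ a * b := by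
  rw [hp.dvd_mul, hp.dvd_mul, hp.prime.dvd_pow_iff_dvd two_ne_zero]

theorem conductorExponent_eq_zero_of_not_dvd [FiniteDimensional F N]
    [Nontrivial (N ≃ₐ[F] N)] {a b p : ℕ} {P : HeightOneSpectrum (𝓞 N)} (hα : IsKummerGenerator F α)
    (h : α ^ 3 = a * b ^ 2) (hp : p.Prime) (hP : (p : 𝓞 N) ∈ P.asIdeal) (hp3 : p ≠ 3)
    (hpab : ¬ p ∣ a * b) :
    conductorExponent F N P = 0 := by
  have hmem {n : ℕ} := natCast_mem_iff_dvd P.isPrime.ne_top hp hP (n := n)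
  refine conductorExponent_eq_zero_of_notMem hα ?_ fun hαP => hpab ?_
  · exact_mod_cast mt hmem.1 (mt (Nat.prime_dvd_prime_iff_eq hp Nat.prime_three).1 hp3)
  · rw [← prime_dvd_mul_sq_iff hp, ← hmem]
    have hpow := P.asIdeal.pow_mem_of_mem hαP 3 three_pos
    rw [h] at hpow
    exact_mod_cast hpow

end KummerGenerators

section Conductor

/-- The integer `f` such that `f ℤ[ω]` is the conductor of `ℚ(ω, ∛(ab²)) / ℚ(ω)`, for `ab`
squarefree and `(a, b) ≠ (1, 1)`. -/
def radicandConductor (a b : ℕ) : ℕ :=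
  if a * b ^ 2 % 9 = 1 ∨ a * b ^ 2 % 9 = 8 then a * b else 3 * (a * b)

theorem radicandConductor_ne_zero {a b : ℕ} (h : a * b ≠ 0) : radicandConductor a b ≠ 0 := by
  rw [radicandConductor]
  split_ifs
  exacts [h, mul_ne_zero three_ne_zero h]

theorem factorization_radicandConductor {a b : ℕ} (h : a * b ≠ 0) (p : ℕ) :
    (radicandConductor a b).factorization p = (a * b).factorization p +
      if p = 3 ∧ ¬ (a * b ^ 2 % 9 = 1 ∨ a * b ^ 2 % 9 = 8) then 1 else 0 := by
  rw [radicandConductor]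
  split_ifs <;>
    simp_all [Nat.factorization_mul three_ne_zero h, Nat.prime_three.factorization, add_comm,
      eq_comm]

variable {F N : Type*} [Field F] [NumberField F] [IsCyclotomicExtension {3} ℚ F]

theorem val_natCast {P : HeightOneSpectrum (𝓞 F)} {p n : ℕ} (hp : p.Prime)
    (h : (p : 𝓞 F) ∈ P.asIdeal) (hn : n ≠ 0) :
    val P (n : 𝓞 F) = (n.factorization p * if p = 3 then 2 else 1 : ℕ) := by
  conv_lhs => rw [← Nat.ordProj_mul_ordCompl_eq_self n p]
  rw [Nat.cast_mul, val_mul, val_natCast_of_not_dvd hp h (Nat.not_dvd_ordCompl hp hn), add_zero,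
    Nat.cast_pow, val_pow, Nat.cast_mul]
  congr 1
  split_ifs with hp3
  · subst hp3
    exact_mod_cast val_three_eq_two (by exact_mod_cast h)
  · exact_mod_cast val_natCast_eq_one hp hp3 h

variable [Field N] [Algebra F N]

theorem emultiplicity_under_span_natCast {P : HeightOneSpectrum (𝓞 N)} {p n : ℕ} (hp : p.Prime)
    (hP : (p : 𝓞 N) ∈ P.asIdeal) (hn : n ≠ 0) :
    emultiplicity (P.asIdeal.under (𝓞 F)) (Ideal.span {(n : 𝓞 F)}) =
      (n.factorization p * if p = 3 then 2 else 1 : ℕ) :=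
  val_natCast (P := P.under (𝓞 F)) hp (natCast_mem_under_iff.2 hP) hn

variable [NumberField N] [IsGalois F N] [Nontrivial (N ≃ₐ[F] N)] {a b p : ℕ} {α : 𝓞 N}
  {P : HeightOneSpectrum (𝓞 N)}

theorem conductorExponent_eq_of_dvd_left (hd : Module.finrank F N = 3)
    (hab : Squarefree (a * b)) (hα : IsKummerGenerator F α) (h : α ^ 3 = a * b ^ 2)
    (hp : p.Prime) (hP : (p : 𝓞 N) ∈ P.asIdeal) (hpa : p ∣ a) :
    conductorExponent F N P = if p = 3 then 4 else 1 := by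
  obtain ⟨c, rfl⟩ := hpa
  have hc : ¬ p ∣ c * b ^ 2 := fun hdvd => hp.not_isUnit <| hab p <| by
    rw [mul_assoc p c b]
    exact mul_dvd_mul_left p ((prime_dvd_mul_sq_iff hp).1 hdvd)
  have hβ := mt (natCast_mem_iff_dvd P.isPrime.ne_top hp hP).1 hc
  have hcube : α ^ 3 = p * (c * b ^ 2 : ℕ) := by
    rw [h]
    push_cast
    ring
  split_ifs with hp3
  · subst hp3
    exact conductorExponent_eq_four hd hα hβ (by exact_mod_cast hcube) (by exact_mod_cast hP)
  · exact conductorExponent_eq_one hd hα hp hp3 hβ hcube hP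

theorem conductorExponent_eq_of_dvd_mul (hd : Module.finrank F N = 3)
    (hab : Squarefree (a * b)) (hα : IsKummerGenerator F α) (h : α ^ 3 = a * b ^ 2)
    (hp : p.Prime) (hP : (p : 𝓞 N) ∈ P.asIdeal) (hpab : p ∣ a * b) :
    conductorExponent F N P = if p = 3 then 4 else 1 := by
  rcases hp.dvd_mul.1 hpab with hpa | hpb
  · exact conductorExponent_eq_of_dvd_left hd hab hα h hp hP hpa
  · obtain ⟨β, hβ, hβ3⟩ := hα.exists_pow_three_eq (right_ne_zero_of_mul hab.ne_zero) h
    exact conductorExponent_eq_of_dvd_left hd (mul_comm a b ▸ hab) hβ hβ3 hp hP hpb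

theorem conductorExponent_eq_of_not_three_dvd (hd : Module.finrank F N = 3)
    (hα : IsKummerGenerator F α) (h : α ^ 3 = a * b ^ 2) (hP : (3 : 𝓞 N) ∈ P.asIdeal)
    (hab : ¬ 3 ∣ a * b) :
    conductorExponent F N P =
      if a * b ^ 2 % 9 = 1 ∨ a * b ^ 2 % 9 = 8 then 0 else 2 := by
  rw [← prime_dvd_mul_sq_iff Nat.prime_three] at hab
  obtain ⟨u, β, hβ, hβu, hu⟩ : ∃ (u : ℤ) (β : 𝓞 N), IsKummerGenerator F β ∧
      β ^ 3 = 1 + 3 * u ∧ ((a * b ^ 2 : ℕ) = 1 + 3 * u ∨ -(a * b ^ 2 : ℕ) = 1 + 3 * u) := by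
    have hcube : α ^ 3 = ((a * b ^ 2 : ℕ) : ℤ) := by exact_mod_cast h
    rcases (by omega : a * b ^ 2 % 3 = 1 ∨ a * b ^ 2 % 3 = 2) with h1 | h2
    · obtain ⟨u, hu⟩ : ∃ u : ℤ, (a * b ^ 2 : ℕ) = 1 + 3 * u := ⟨(a * b ^ 2 : ℕ) / 3, by omega⟩
      exact ⟨u, α, hα, by rw [hcube, hu]; push_cast; rfl, .inl hu⟩
    · obtain ⟨u, hu⟩ : ∃ u : ℤ, -(a * b ^ 2 : ℕ) = 1 + 3 * u :=
        ⟨-((a * b ^ 2 : ℕ) / 3) - 1, by omega⟩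
      refine ⟨u, -α, hα.neg, ?_, .inr hu⟩
      rw [Odd.neg_pow (by decide), hcube, ← Int.cast_neg, hu]
      push_cast
      rfl
  split_ifs with h9
  · obtain ⟨v, rfl⟩ : 3 ∣ u := by omega
    exact conductorExponent_eq_zero_of_pow_three_eq (u := v) hβ
      (by rw [hβu]; push_cast; ring) hP
  · exact conductorExponent_eq_two hd hβ (by omega) hβu hP

theorem isConductor_radicandConductor (hd : Module.finrank F N = 3)
    (hab : Squarefree (a * b)) (hα : IsKummerGenerator F α) (h : α ^ 3 = a * b ^ 2) :
    IsConductor F N (Ideal.span {(radicandConductor a b : 𝓞 F)}) := by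
  intro P
  have : NeZero P.asIdeal := ⟨P.ne_bot⟩
  obtain ⟨p, hp, hP⟩ : ∃ p : ℕ, p.Prime ∧ (p : 𝓞 N) ∈ P.asIdeal :=
    ⟨_, Nat.absNorm_under_prime P.asIdeal, Int.absNorm_under_mem P.asIdeal⟩
  rw [emultiplicity_under_span_natCast hp hP (radicandConductor_ne_zero hab.ne_zero),
    factorization_radicandConductor hab.ne_zero, Nat.cast_inj]
  by_cases hdvd : p ∣ a * b
  · rw [conductorExponent_eq_of_dvd_mul hd hab hα h hp hP hdvd,
      Nat.factorization_eq_one_of_squarefree hab hp hdvd]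
    rcases eq_or_ne p 3 with rfl | hp3
    · have := (prime_dvd_mul_sq_iff hp).2 hdvd
      simp only [true_and, if_true]
      rw [if_pos (by omega)]
    · simp [hp3]
  · rw [Nat.factorization_eq_zero_of_not_dvd hdvd]
    rcases eq_or_ne p 3 with rfl | hp3
    · rw [conductorExponent_eq_of_not_three_dvd hd hα h (by exact_mod_cast hP) hdvd]
      split_ifs <;> simp_all
    · rw [conductorExponent_eq_zero_of_not_dvd hα h hp hP hp3 hdvd]
      simp [hp3]

end Conductor

section Uniqueness

variable {F N : Type*} [Field F] [Field N] [Algebra F N] [NumberField F]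

theorem IsConductor.dvd {I J : Ideal (𝓞 F)} (hI : IsConductor F N I) (hJ : IsConductor F N J)
    (hI0 : I ≠ 0) : I ∣ J := by
  refine (UniqueFactorizationMonoid.dvd_iff_emultiplicity_le hI0).2 fun Q hQ => ?_
  have hQ' := Ideal.isPrime_of_prime hQ
  obtain ⟨P, hP, hPQ⟩ := Q.nonempty_primesOver (S := 𝓞 N)
  have h := (hI ⟨P, hP, Ideal.ne_bot_of_liesOver_of_ne_bot hQ.ne_zero P⟩).trans (hJ _).symm
  rw [← hPQ.over] at h
  exact h.le

theorem IsConductor.natCast_unique {m n : ℕ}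
    (hm : IsConductor F N (Ideal.span {(m : 𝓞 F)})) (hn : IsConductor F N (Ideal.span {(n : 𝓞 F)}))
    (hm0 : m ≠ 0) (hn0 : n ≠ 0) : m = n := by
  have hspan {k : ℕ} (hk : k ≠ 0) : Ideal.span {(k : 𝓞 F)} ≠ 0 := by simpa using hk
  have h := congrArg Ideal.absNorm (dvd_antisymm (hm.dvd hn (hspan hm0)) (hn.dvd hm (hspan hn0)))
  rw [Ideal.absNorm_span_natCast, Ideal.absNorm_span_natCast] at h
  exact Nat.pow_left_injective (Module.finrank_pos (R := ℤ) (M := 𝓞 F)).ne' h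

end Uniqueness

section CubeFree

theorem eq_and_eq_of_mul_sq_mul_cube_eq {a b c d u w : ℕ} (hab : Squarefree (a * b))
    (hcd : Squarefree (c * d)) (hu : u ≠ 0) (hw : w ≠ 0)
    (h : a * b ^ 2 * u ^ 3 = c * d ^ 2 * w ^ 3) : a = c ∧ b = d := by
  have ha := left_ne_zero_of_mul hab.ne_zero
  have hb := right_ne_zero_of_mul hab.ne_zero
  have hc := left_ne_zero_of_mul hcd.ne_zero
  have hd := right_ne_zero_of_mul hcd.ne_zero
  have hval {a b u : ℕ} (ha : a ≠ 0) (hb : b ≠ 0) (hu : u ≠ 0) (p : ℕ) :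
      (a * b ^ 2 * u ^ 3).factorization p =
        a.factorization p + 2 * b.factorization p + 3 * u.factorization p := by
    simp [Nat.factorization_mul, Nat.factorization_pow, ha, hb, hu]
  have hle {a b : ℕ} (hab : Squarefree (a * b)) (p : ℕ) :
      a.factorization p + b.factorization p ≤ 1 := by
    rw [← Finsupp.add_apply, ← Nat.factorization_mul (left_ne_zero_of_mul hab.ne_zero)
      (right_ne_zero_of_mul hab.ne_zero)]
    exact hab.natFactorization_le_one p
  have hfact (p : ℕ) :
      a.factorization p = c.factorization p ∧ b.factorization p = d.factorization p := by
    have hp := congrArg (Nat.factorization · p) h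
    simp only [hval ha hb hu, hval hc hd hw] at hp
    have := hle hab p
    have := hle hcd p
    omega
  exact ⟨Nat.eq_of_factorization_eq ha hc fun p => (hfact p).1,
    Nat.eq_of_factorization_eq hb hd fun p => (hfact p).2⟩

theorem eq_and_eq_of_eq_cube_mul {a b c d : ℕ} (hab : Squarefree (a * b))
    (hcd : Squarefree (c * d)) {q : ℚ} (h : (c * d ^ 2 : ℚ) = q ^ 3 * (a * b ^ 2)) :
    a = c ∧ b = d := by
  have hc := left_ne_zero_of_mul hcd.ne_zero
  have hd := right_ne_zero_of_mul hcd.ne_zero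
  have hq : q ≠ 0 := by
    rintro rfl
    have hcd0 : (c * d ^ 2 : ℚ) ≠ 0 := by positivity
    exact hcd0 (by rw [h]; ring)
  refine eq_and_eq_of_mul_sq_mul_cube_eq (u := q.num.natAbs) (w := q.den) hab hcd
    (by simpa using hq) q.den_ne_zero ?_
  have hden : (q.den : ℚ) ≠ 0 := by exact_mod_cast q.den_ne_zero
  have hrat : (a * b ^ 2 * q.num ^ 3 : ℚ) = c * d ^ 2 * q.den ^ 3 := by
    rw [h]
    nth_rewrite 2 [← Rat.num_div_den q]
    field_simp
  have hint : (a * b ^ 2 * q.num ^ 3 : ℤ) = c * d ^ 2 * q.den ^ 3 := by exact_mod_cast hrat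
  simpa [Int.natAbs_mul, Int.natAbs_pow] using congrArg Int.natAbs hint

theorem exists_eq_mul_sq_mul_cube {n : ℕ} (hn : n ≠ 0) :
    ∃ a b c : ℕ, Squarefree (a * b) ∧ n = a * b ^ 2 * c ^ 3 := by
  induction n using induction_on_primes with
  | zero => exact absurd rfl hn
  | one => exact ⟨1, 1, 1, by simp, by simp⟩
  | prime_mul p n hp ih =>
    obtain ⟨a, b, c, hab, rfl⟩ := ih (right_ne_zero_of_mul hn)
    by_cases hpab : p ∣ a * b
    · rcases hp.dvd_mul.1 hpab with ⟨a', rfl⟩ | ⟨b', rfl⟩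
      · exact ⟨a', p * b, c, by rwa [show a' * (p * b) = p * a' * b by ring], by ring⟩
      · exact ⟨a, b', p * c, hab.squarefree_of_dvd (mul_dvd_mul_left _ (dvd_mul_left _ _)), by ring⟩
    · refine ⟨p * a, b, c, ?_, by ring⟩
      rw [mul_assoc, Nat.squarefree_mul ((Nat.Prime.coprime_iff_not_dvd hp).2 hpab)]
      exact ⟨hp.prime.squarefree, hab⟩

theorem exists_int_eq_cube_mul_mul_sq {m : ℤ} (hm : m ≠ 0) :
    ∃ (a b : ℕ) (c : ℤ), Squarefree (a * b) ∧ m = c ^ 3 * (a * b ^ 2) := by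
  obtain ⟨a, b, c, hab, hn⟩ := exists_eq_mul_sq_mul_cube (Int.natAbs_ne_zero.2 hm)
  rcases Int.natAbs_eq m with h | h
  · exact ⟨a, b, c, hab, by rw [h, hn]; push_cast; ring⟩
  · exact ⟨a, b, -c, hab, by rw [h, hn]; push_cast; ring⟩

/-- The pairs `(a, b)` parametrising the pure cubic fields `ℚ(∛(ab²))`. Each field arises from
exactly two of them, `(a, b)` and `(b, a)`. -/
def IsRadicand (a b : ℕ) : Prop := Squarefree (a * b) ∧ ¬ (a = 1 ∧ b = 1)

theorem IsRadicand.symm {a b : ℕ} (h : IsRadicand a b) : IsRadicand b a :=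
  ⟨mul_comm a b ▸ h.1, fun h' => h.2 h'.symm⟩

theorem IsRadicand.ne {a b : ℕ} (h : IsRadicand a b) : a ≠ b := by
  rintro rfl
  have ha : a = 1 := Nat.isUnit_iff.1 (h.1 a dvd_rfl)
  exact h.2 ⟨ha, ha⟩

theorem IsRadicand.cube_ne {a b : ℕ} (h : IsRadicand a b) (q : ℚ) : q ^ 3 ≠ a * b ^ 2 := by
  intro hq
  obtain ⟨ha, hb⟩ := eq_and_eq_of_eq_cube_mul (a := 1) (b := 1) (q := q) (by simp) h.1
    (by rw [← hq]; simp)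
  exact h.2 ⟨ha.symm, hb.symm⟩

end CubeFree

section CubeRoots

open Polynomial IntermediateField

variable {k E L : Type*} [Field k] [Field E] [Algebra k E] [Field L] [Algebra k L] {m n : k}
  {η : E} {ω θ : L}

theorem isIntegral_of_pow_three_eq (hη : η ^ 3 = algebraMap k E m) : IsIntegral k η :=
  .of_pow three_pos (hη ▸ isIntegral_algebraMap)

theorem minpoly_eq_X_pow_three_sub_C (hm : ∀ q : k, q ^ 3 ≠ m) (hη : η ^ 3 = algebraMap k E m) :
    minpoly k η = X ^ 3 - C m :=
  (minpoly.eq_of_irreducible_of_monic (X_pow_sub_C_irreducible_of_prime Nat.prime_three hm)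
    (by simp [hη]) (monic_X_pow_sub_C m three_ne_zero)).symm

theorem finrank_adjoin_of_pow_three_eq (hm : ∀ q : k, q ^ 3 ≠ m)
    (hη : η ^ 3 = algebraMap k E m) : Module.finrank k k⟮η⟯ = 3 := by
  rw [adjoin.finrank (isIntegral_of_pow_three_eq hη), minpoly_eq_X_pow_three_sub_C hm hη,
    natDegree_X_pow_sub_C]

theorem adjoin_eq_top_of_pow_three_eq (hd : Module.finrank k E = 3) (hm : ∀ q : k, q ^ 3 ≠ m)
    (hη : η ^ 3 = algebraMap k E m) : k⟮η⟯ = ⊤ := by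
  have : FiniteDimensional k E := Module.finite_of_finrank_pos (by omega)
  refine eq_of_le_of_finrank_eq le_top ?_
  rw [finrank_adjoin_of_pow_three_eq hm hη, finrank_top', hd]

theorem pow_three_ne_of_adjoin_eq_top (hd : Module.finrank k E = 3) (htop : k⟮η⟯ = ⊤)
    (hη : η ^ 3 = algebraMap k E m) (q : k) : q ^ 3 ≠ m := by
  have hint := isIntegral_of_pow_three_eq hη
  have hdeg : (minpoly k η).natDegree = 3 := by
    rw [← adjoin.finrank hint, htop, finrank_top', hd]
  have hmin : X ^ 3 - C m = minpoly k η :=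
    eq_of_monic_of_dvd_of_natDegree_le (minpoly.monic hint)
      (monic_X_pow_sub_C m three_ne_zero) (minpoly.dvd k η (by simp [hη])) (by simp [hdeg])
  exact (X_pow_sub_C_irreducible_iff_of_prime Nat.prime_three).1
    (hmin ▸ minpoly.irreducible hint) q

theorem pow_three_ne_algebraMap (hE : ¬ 3 ∣ Module.finrank k E) (hm : ∀ q : k, q ^ 3 ≠ m) (x : E) :
    x ^ 3 ≠ algebraMap k E m := fun hx => hE <| by
  have hdvd := minpoly.degree_dvd (isIntegral_of_pow_three_eq hx)
  rwa [minpoly_eq_X_pow_three_sub_C hm hx, natDegree_X_pow_sub_C] at hdvd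

theorem exists_algHom_apply_eq (htop : k⟮η⟯ = ⊤) (hm : ∀ q : k, q ^ 3 ≠ m)
    (hη : η ^ 3 = algebraMap k E m) (hθ : θ ^ 3 = algebraMap k L m) :
    ∃ f : E →ₐ[k] L, f η = θ := by
  have hint := isIntegral_of_pow_three_eq hη
  let pb := PowerBasis.ofAdjoinEqTop hint
    ((adjoin_simple_eq_top_iff_of_isAlgebraic hint.isAlgebraic).1 htop)
  have hgen : pb.gen = η := PowerBasis.ofAdjoinEqTop_gen ..
  have hroot : aeval θ (minpoly k pb.gen) = 0 := by
    rw [hgen, minpoly_eq_X_pow_three_sub_C hm hη]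
    simp [hθ]
  exact ⟨pb.lift θ hroot, by simpa only [hgen] using pb.lift_gen θ hroot⟩

theorem nonempty_algEquiv_of_pow_three_eq (hE : Module.finrank k E = 3)
    (hL : Module.finrank k L = 3) (hm : ∀ q : k, q ^ 3 ≠ m) (hη : η ^ 3 = algebraMap k E m)
    (hθ : θ ^ 3 = algebraMap k L m) : Nonempty (E ≃ₐ[k] L) := by
  have : FiniteDimensional k E := Module.finite_of_finrank_pos (by omega)
  have : FiniteDimensional k L := Module.finite_of_finrank_pos (by omega)
  obtain ⟨f, -⟩ := exists_algHom_apply_eq (adjoin_eq_top_of_pow_three_eq hE hm hη) hm hη hθ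
  have hsurj := (LinearMap.injective_iff_surjective_of_finrank_eq_finrank
    (f := f.toLinearMap) (hE.trans hL.symm)).1 f.injective
  exact ⟨.ofBijective f ⟨f.injective, hsurj⟩⟩

theorem exists_eq_quadratic (hm : ∀ q : k, q ^ 3 ≠ m) (hη : η ^ 3 = algebraMap k E m)
    (htop : k⟮η⟯ = ⊤) (t : E) :
    ∃ x y z : k, t = algebraMap k E x + algebraMap k E y * η + algebraMap k E z * η ^ 2 := by
  have hint := isIntegral_of_pow_three_eq hη
  obtain ⟨f, hf, rfl⟩ := (PowerBasis.ofAdjoinEqTop hint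
    ((adjoin_simple_eq_top_iff_of_isAlgebraic hint.isAlgebraic).1 htop)).exists_eq_aeval t
  rw [PowerBasis.ofAdjoinEqTop_dim, minpoly_eq_X_pow_three_sub_C hm hη,
    natDegree_X_pow_sub_C] at hf
  refine ⟨f.coeff 0, f.coeff 1, f.coeff 2, ?_⟩
  rw [PowerBasis.ofAdjoinEqTop_gen, aeval_eq_sum_range' hf]
  simp [Finset.sum_range_succ, Algebra.smul_def]

theorem eq_zero_of_quadratic_eq_zero (hm : ∀ q : k, q ^ 3 ≠ m) (hη : η ^ 3 = algebraMap k E m)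
    {x y z : k} (h : algebraMap k E x + algebraMap k E y * η + algebraMap k E z * η ^ 2 = 0) :
    x = 0 ∧ y = 0 ∧ z = 0 := by
  have hp : C z * X ^ 2 + C y * X + C x = 0 := by
    refine eq_zero_of_dvd_of_degree_lt (p := minpoly k η) (minpoly.dvd k η ?_) ?_
    · simp only [map_add, map_mul, aeval_C, map_pow, aeval_X]
      linear_combination h
    · rw [minpoly_eq_X_pow_three_sub_C hm hη, degree_X_pow_sub_C three_pos]
      exact degree_quadratic_lt
  refine ⟨?_, ?_, ?_⟩
  · simpa using congrArg (coeff · 0) hp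
  · simpa [coeff_X, coeff_C] using congrArg (coeff · 1) hp
  · simpa [coeff_X, coeff_C] using congrArg (coeff · 2) hp

theorem exists_eq_cube_mul (h3 : (3 : k) ≠ 0) (hm : ∀ q : k, q ^ 3 ≠ m)
    (hn : ∀ q : k, q ^ 3 ≠ n) (hη : η ^ 3 = algebraMap k E m) (htop : k⟮η⟯ = ⊤) {η' : E}
    (hη' : η' ^ 3 = algebraMap k E n) : ∃ q : k, n = q ^ 3 * m ∨ n = q ^ 3 * m ^ 2 := by
  obtain ⟨x, y, z, rfl⟩ := exists_eq_quadratic hm hη htop η'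
  have hm0 : m ≠ 0 := fun h => hm 0 (by simp [h])
  -- the coefficients of `η'³ - n` in the basis `1, η, η²`
  obtain ⟨hone, hlin, hquad⟩ := eq_zero_of_quadratic_eq_zero hm hη
    (x := x ^ 3 + m * y ^ 3 + m ^ 2 * z ^ 3 + 6 * m * x * y * z - n)
    (y := 3 * (x ^ 2 * y + m * x * z ^ 2 + m * y ^ 2 * z))
    (z := 3 * (x ^ 2 * z + x * y ^ 2 + m * y * z ^ 2)) (by
      simp only [map_add, map_sub, map_mul, map_pow, map_ofNat]
      rw [← hη, ← hη']
      ring)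
  replace hlin := (mul_eq_zero.1 hlin).resolve_left h3
  replace hquad := (mul_eq_zero.1 hquad).resolve_left h3
  have hx : x * (m * z ^ 3 - y ^ 3) = 0 := by linear_combination z * hlin - y * hquad
  rcases mul_eq_zero.1 hx with rfl | hx
  · have hyz : m * y ^ 2 * z = 0 := by linear_combination hlin
    rcases mul_eq_zero.1 hyz with hy | rfl
    · obtain rfl : y = 0 := by simpa [hm0] using hy
      exact ⟨z, .inr (by linear_combination -hone)⟩
    · exact ⟨y, .inl (by linear_combination -hone)⟩
  · obtain rfl : z = 0 := by
      by_contra hz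
      refine hm (y / z) ?_
      field_simp
      linear_combination -hx
    obtain rfl : y = 0 := by simpa using hx
    exact absurd (by linear_combination hone) (hn x)

theorem normalClosure_eq_adjoin (hω : ω ^ 2 + ω + 1 = 0) (hm : ∀ q : k, q ^ 3 ≠ m)
    (hη : η ^ 3 = algebraMap k E m) (htop : k⟮η⟯ = ⊤) (hθ : θ ^ 3 = algebraMap k L m) :
    normalClosure k E L = adjoin k {ω, θ} := by
  have hωθ : (ω * θ) ^ 3 = algebraMap k L m := by linear_combination hθ + θ ^ 3 * (ω - 1) * hω
  have hmem {t : L} (ht : t ^ 3 = algebraMap k L m) : t ∈ normalClosure k E L := by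
    obtain ⟨f, rfl⟩ := exists_algHom_apply_eq htop hm hη ht
    exact f.fieldRange_le_normalClosure ⟨η, rfl⟩
  refine le_antisymm (iSup_le fun f => ?_) (adjoin_le_iff.2 ?_)
  · have hω' : ω ∈ adjoin k {ω, θ} := subset_adjoin _ _ (by simp)
    have hθ' : θ ∈ adjoin k {ω, θ} := subset_adjoin _ _ (by simp)
    have hf : f η ^ 3 = θ ^ 3 := by rw [← map_pow, hη, f.commutes, hθ]
    rw [f.fieldRange_eq_map, ← htop, adjoin_map, Set.image_singleton, adjoin_simple_le_iff]
    rcases eq_or_eq_mul_of_pow_three_eq hω hf with h | h | h <;> rw [h]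
    exacts [hθ', mul_mem hω' hθ', mul_mem (pow_mem hω' 2) hθ']
  · have hθ0 : θ ≠ 0 := by
      rintro rfl
      exact hm 0 ((algebraMap k L).injective (by simpa using hθ))
    rintro x (rfl | rfl)
    · simpa [hθ0] using div_mem (hmem hωθ) (hmem hθ)
    · exact hmem hθ

end CubeRoots

section PureCubicFields

open IntermediateField

variable {K : Type*} [Field K] [Algebra ℚ K] {a b c d : ℕ} {η η' : K}

theorem algebraMap_radicand : algebraMap ℚ K (a * b ^ 2) = a * b ^ 2 := by
  rw [map_mul, map_pow, map_natCast, map_natCast]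

theorem exists_isRadicand_of_isPureCubic (h : IsPureCubic K) :
    ∃ a b : ℕ, IsRadicand a b ∧ ∃ η : K, η ^ 3 = a * b ^ 2 := by
  obtain ⟨hd, m, θ, hθ, htop⟩ := h
  have : CharZero K := algebraRat.charZero K
  have hm : ∀ q : ℚ, q ^ 3 ≠ m := pow_three_ne_of_adjoin_eq_top hd htop (by rw [hθ, map_intCast])
  have hm0 : m ≠ 0 := by
    rintro rfl
    exact hm 0 (by simp)
  obtain ⟨a, b, c, hab, rfl⟩ := exists_int_eq_cube_mul_mul_sq hm0
  have hc : (c : K) ≠ 0 := Int.cast_ne_zero.2 (pow_ne_zero_iff three_ne_zero |>.1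
    (left_ne_zero_of_mul hm0))
  refine ⟨a, b, ⟨hab, ?_⟩, θ / c, ?_⟩
  · rintro ⟨rfl, rfl⟩
    exact hm c (by simp)
  · rw [div_pow, hθ, div_eq_iff (pow_ne_zero 3 hc)]
    push_cast
    ring

theorem adjoin_eq_top_of_isRadicand (hd : Module.finrank ℚ K = 3) (h : IsRadicand a b)
    (hη : η ^ 3 = a * b ^ 2) : ℚ⟮η⟯ = ⊤ :=
  adjoin_eq_top_of_pow_three_eq hd h.cube_ne (hη.trans algebraMap_radicand.symm)

theorem isPureCubic_of_isRadicand (hd : Module.finrank ℚ K = 3) (h : IsRadicand a b)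
    (hη : η ^ 3 = a * b ^ 2) : IsPureCubic K :=
  ⟨hd, (a * b ^ 2 : ℕ), η, by simpa using hη, adjoin_eq_top_of_isRadicand hd h hη⟩

theorem exists_pow_three_eq_symm (h : IsRadicand a b) (hη : η ^ 3 = a * b ^ 2) :
    ∃ η' : K, η' ^ 3 = b * a ^ 2 := by
  have : CharZero K := algebraRat.charZero K
  have hb : (b : K) ≠ 0 := by exact_mod_cast right_ne_zero_of_mul h.1.ne_zero
  refine ⟨η ^ 2 / b, ?_⟩
  rw [div_pow, pow_right_comm, hη]
  field_simp

theorem eq_or_eq_symm_of_pow_three_eq (hd : Module.finrank ℚ K = 3) (h : IsRadicand a b)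
    (h' : IsRadicand c d) (hη : η ^ 3 = a * b ^ 2) (hη' : η' ^ 3 = c * d ^ 2) :
    (a = c ∧ b = d) ∨ (b = c ∧ a = d) := by
  have htop := adjoin_eq_top_of_isRadicand hd h hη
  rw [← algebraMap_radicand] at hη hη'
  obtain ⟨q, hq | hq⟩ := exists_eq_cube_mul three_ne_zero h.cube_ne h'.cube_ne hη htop hη'
  · exact .inl (eq_and_eq_of_eq_cube_mul h.1 h'.1 hq)
  · exact .inr (eq_and_eq_of_eq_cube_mul (q := q * b) h.symm.1 h'.1 (by rw [hq]; ring))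

end PureCubicFields

section QuadraticSubfield

open IntermediateField

theorem mem_range_algebraMap_of_odd_finrank {F L : Type*} [Field F] [Field L] [Algebra F L]
    (hodd : Odd (Module.finrank F L)) {ω : L} (hω : ω ^ 2 + ω + 1 = 0) :
    ω ∈ (algebraMap F L).range := by
  have : FiniteDimensional F L := Module.finite_of_finrank_pos hodd.pos
  have hdvd : minpoly F ω ∣ .X ^ 2 + .X + 1 := minpoly.dvd F ω (by simpa using hω)
  have hle : (minpoly F ω).natDegree ≤ 2 := by
    refine (Polynomial.natDegree_le_of_dvd hdvd (Polynomial.Monic.ne_zero (by monicity!))).trans ?_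
    compute_degree
  have hpos := minpoly.natDegree_pos (Algebra.IsIntegral.isIntegral (R := F) ω)
  obtain ⟨j, hj⟩ := hodd.of_dvd_nat (minpoly.degree_dvd (Algebra.IsIntegral.isIntegral ω))
  exact minpoly.natDegree_eq_one_iff.1 (by omega)

variable {N : Type*} [Field N] [CharZero N] {ω θ : N} {m : ℚ}

theorem isPrimitiveRoot_of_sq_add_add_one_eq_zero (hω : ω ^ 2 + ω + 1 = 0) :
    IsPrimitiveRoot ω 3 := by
  rw [← Polynomial.isRoot_cyclotomic_iff]
  simp [Polynomial.cyclotomic_three, hω]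

theorem finrank_adjoin_of_sq_add_add_one_eq_zero (hω : ω ^ 2 + ω + 1 = 0) :
    Module.finrank ℚ ℚ⟮ω⟯ = 2 := by
  have hprim := isPrimitiveRoot_of_sq_add_add_one_eq_zero hω
  rw [adjoin.finrank (hprim.isIntegral three_pos).tower_top,
    ← Polynomial.cyclotomic_eq_minpoly_rat hprim three_pos, Polynomial.natDegree_cyclotomic,
    Nat.totient_prime Nat.prime_three]

theorem finrank_eq_three_of_adjoin_eq_top (hω : ω ^ 2 + ω + 1 = 0) (hm : ∀ q : ℚ, q ^ 3 ≠ m)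
    (hθ : θ ^ 3 = algebraMap ℚ N m) (htop : ℚ⟮ω⟯⟮θ⟯ = ⊤) : Module.finrank ℚ⟮ω⟯ N = 3 := by
  have hm' : ∀ x : ℚ⟮ω⟯, x ^ 3 ≠ algebraMap ℚ ℚ⟮ω⟯ m := pow_three_ne_algebraMap
    (by rw [finrank_adjoin_of_sq_add_add_one_eq_zero hω]; decide) hm
  rw [← finrank_top', ← htop,
    finrank_adjoin_of_pow_three_eq hm' (hθ.trans (IsScalarTower.algebraMap_apply ..))]

theorem eq_adjoin_of_finrank_eq_two [FiniteDimensional ℚ N] (hω : ω ^ 2 + ω + 1 = 0)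
    {F : IntermediateField ℚ N} (hF : Module.finrank ℚ F = 2) (hodd : Odd (Module.finrank F N)) :
    F = ℚ⟮ω⟯ := by
  obtain ⟨x, hx⟩ := mem_range_algebraMap_of_odd_finrank hodd hω
  refine (eq_of_le_of_finrank_eq (adjoin_simple_le_iff.2 (hx ▸ x.2)) ?_).symm
  rw [hF, finrank_adjoin_of_sq_add_add_one_eq_zero hω]

theorem isCyclotomicExtension_adjoin [Algebra.IsIntegral ℚ N] (hω : ω ^ 2 + ω + 1 = 0) :
    IsCyclotomicExtension {3} ℚ ℚ⟮ω⟯ := by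
  have hprim := isPrimitiveRoot_of_sq_add_add_one_eq_zero hω
  -- two propositionally equal `ℚ`-algebra structures
  convert hprim.intermediateField_adjoin_isCyclotomicExtension ℚ
  · rfl
  · exact Subsingleton.elim _ _

variable [NumberField N] [IsGalois ℚ N] {a b : ℕ}

theorem isConductor_adjoin (hab : IsRadicand a b) (hω : ω ^ 2 + ω + 1 = 0)
    (hθ : θ ^ 3 = a * b ^ 2) (htop : ℚ⟮ω⟯⟮θ⟯ = ⊤) :
    IsConductor ℚ⟮ω⟯ N (Ideal.span {(radicandConductor a b : 𝓞 ℚ⟮ω⟯)}) := by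
  have hd : Module.finrank ℚ⟮ω⟯ N = 3 := finrank_eq_three_of_adjoin_eq_top hω hab.cube_ne
    (hθ.trans algebraMap_radicand.symm) htop
  have : IsCyclotomicExtension {3} ℚ ℚ⟮ω⟯ := isCyclotomicExtension_adjoin hω
  have : Nontrivial (N ≃ₐ[ℚ⟮ω⟯] N) := by
    rw [← Finite.one_lt_card_iff_nontrivial, IsGalois.card_aut_eq_finrank, hd]
    norm_num
  have hint : IsIntegral ℤ θ := .of_pow three_pos (by
    rw [hθ]
    exact_mod_cast isIntegral_algebraMap (R := ℤ) (A := N) (x := (a * b ^ 2 : ℕ)))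
  let α : 𝓞 N := ⟨θ, hint⟩
  have hα : α ^ 3 = a * b ^ 2 := RingOfIntegers.ext hθ
  obtain ⟨z, hz⟩ := exists_sq_add_add_one_eq_zero ℚ⟮ω⟯
  have hgen : IsKummerGenerator ℚ⟮ω⟯ α :=
    isKummerGenerator_of_pow_three_eq (c := (a * b ^ 2 : ℕ)) hz (hα.trans (by simp)) htop
  exact isConductor_radicandConductor hd hab.1 hgen hα

theorem isResolventConductor_iff (hab : IsRadicand a b) (hω : ω ^ 2 + ω + 1 = 0)
    (hθ : θ ^ 3 = a * b ^ 2) (htop : ℚ⟮ω⟯⟮θ⟯ = ⊤) (f : ℕ) :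
    IsResolventConductor N f ↔ f = radicandConductor a b := by
  have hcond := isConductor_adjoin hab hω hθ htop
  have h0 := radicandConductor_ne_zero hab.1.ne_zero
  have h2 := finrank_adjoin_of_sq_add_add_one_eq_zero hω
  constructor
  · rintro ⟨hf, F, hF, hfF⟩
    have h3 := finrank_eq_three_of_adjoin_eq_top hω hab.cube_ne
      (hθ.trans algebraMap_radicand.symm) htop
    have hFN : Module.finrank F N = 3 := by
      have := Module.finrank_mul_finrank ℚ ℚ⟮ω⟯ N
      have := Module.finrank_mul_finrank ℚ F N
      rw [hF] at this
      rw [h2, h3] at *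
      omega
    obtain rfl := eq_adjoin_of_finrank_eq_two hω hF (hFN ▸ by decide)
    exact hfF.natCast_unique hcond hf.ne' h0
  · rintro rfl
    exact ⟨Nat.pos_of_ne_zero h0, _, h2, hcond⟩

end QuadraticSubfield

section GaloisClosure

open IntermediateField

-- The `ℚ`-algebra structures on `AlgebraicClosure ℚ` coming from the construction of the algebraic
-- closure and from its characteristic are only propositionally equal.
theorem isAlgebraic_algebraicClosure : Algebra.IsAlgebraic ℚ (AlgebraicClosure ℚ) := by
  convert AlgebraicClosure.isAlgebraic ℚ
  · rfl
  · exact Subsingleton.elim _ _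

theorem normal_algebraicClosure : Normal ℚ (AlgebraicClosure ℚ) :=
  have := isAlgebraic_algebraicClosure
  normal_iff.2 fun x => ⟨Algebra.IsIntegral.isIntegral x, IsAlgClosed.splits _⟩

variable (K : Type*) [Field K] [Algebra ℚ K] [FiniteDimensional ℚ K]

theorem numberField_galoisClosure : NumberField (galoisClosure K) where
  to_finiteDimensional := by
    convert normalClosure.is_finiteDimensional ℚ K (AlgebraicClosure ℚ)

theorem isGalois_galoisClosure : IsGalois ℚ (galoisClosure K) where
  to_isSeparable :=
    have := numberField_galoisClosure K
    inferInstance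
  to_normal := by
    have := normal_algebraicClosure
    convert normalClosure.normal ℚ K (AlgebraicClosure ℚ)
    exact Subsingleton.elim _ _

variable {K}

theorem exists_sq_add_add_one_eq_zero_of_isAlgClosed (L : Type*) [Field L] [IsAlgClosed L] :
    ∃ ω : L, ω ^ 2 + ω + 1 = 0 := by
  obtain ⟨ω, hω⟩ := IsAlgClosed.exists_root (Polynomial.cyclotomic 3 L)
    (Polynomial.degree_cyclotomic_pos 3 L three_pos).ne'
  exact ⟨ω, by simpa [Polynomial.cyclotomic_three] using hω⟩

theorem adjoin_adjoin_simple_eq_top {k L : Type*} [Field k] [Field L] [Algebra k L] {x y : L}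
    (h : adjoin k {x, y} = ⊤) : k⟮x⟯⟮y⟯ = ⊤ := by
  have h' := adjoin_adjoin_left k {x} {y}
  rw [Set.singleton_union, h] at h'
  exact restrictScalars_injective k (h'.trans rfl)

theorem adjoin_eq_top_of_eq_adjoin_image {k L : Type*} [Field k] [Field L] [Algebra k L]
    {M : IntermediateField k L} {S : Set M} (h : M = adjoin k ((↑) '' S)) : adjoin k S = ⊤ := by
  apply M.lift_injective
  rw [lift_adjoin, lift_top, ← h]

theorem isCubicConductor_iff (hd : Module.finrank ℚ K = 3) {a b : ℕ} (hab : IsRadicand a b)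
    {η : K} (hη : η ^ 3 = a * b ^ 2) (f : ℕ) :
    IsCubicConductor K f ↔ f = radicandConductor a b := by
  have := numberField_galoisClosure K
  have := isGalois_galoisClosure K
  obtain ⟨ω, hω⟩ := exists_sq_add_add_one_eq_zero_of_isAlgClosed (AlgebraicClosure ℚ)
  obtain ⟨θ, hθ⟩ := IsAlgClosed.exists_pow_nat_eq (a * b ^ 2 : AlgebraicClosure ℚ) three_pos
  have hN : galoisClosure K = adjoin ℚ {ω, θ} := normalClosure_eq_adjoin hω hab.cube_ne
    (hη.trans algebraMap_radicand.symm) (adjoin_eq_top_of_isRadicand hd hab hη)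
    (hθ.trans algebraMap_radicand.symm)
  have hωN : ω ∈ galoisClosure K := hN ▸ subset_adjoin _ _ (by simp)
  have hθN : θ ∈ galoisClosure K := hN ▸ subset_adjoin _ _ (by simp)
  refine isResolventConductor_iff (N := galoisClosure K) (ω := ⟨ω, hωN⟩) (θ := ⟨θ, hθN⟩) hab
    (Subtype.ext hω) (Subtype.ext hθ) (adjoin_adjoin_simple_eq_top ?_) f
  rw [Subsingleton.elim DivisionRing.toRatAlgebra (galoisClosure K).algebra']
  exact adjoin_eq_top_of_eq_adjoin_image (hN.trans (by rw [Set.image_pair]))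

theorem cubicConductor_eq (hd : Module.finrank ℚ K = 3) {a b : ℕ} (hab : IsRadicand a b)
    {η : K} (hη : η ^ 3 = a * b ^ 2) : cubicConductor K = radicandConductor a b := by
  simp [cubicConductor, isCubicConductor_iff hd hab hη]

end GaloisClosure

section SquarefreePairs

open ArithmeticFunction

/-- The term `f a * g b` at the pairs `(a, b)` with `ab` squarefree, and `0` at the other pairs. -/
noncomputable def squarefreePairTerm {R : Type*} [CommRing R] (f g : ArithmeticFunction R)
    (x : ℕ × ℕ) : R :=
  if Squarefree (x.1 * x.2) then f x.1 * g x.2 else 0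

/-- The Dirichlet convolution of `f` and `g`, restricted to squarefree arguments. -/
noncomputable def squarefreeConvolution {R : Type*} [CommRing R] (f g : ArithmeticFunction R)
    (n : ℕ) : R :=
  if Squarefree n then (f * g) n else 0

section Algebra

variable {R : Type*} [CommRing R] {f g : ArithmeticFunction R}

theorem squarefreeConvolution_one (hf : f.IsMultiplicative) (hg : g.IsMultiplicative) :
    squarefreeConvolution f g 1 = 1 :=
  (if_pos squarefree_one).trans (hf.mul hg).map_one

theorem squarefreeConvolution_mul (hf : f.IsMultiplicative) (hg : g.IsMultiplicative) {m n : ℕ}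
    (h : m.Coprime n) :
    squarefreeConvolution f g (m * n) =
      squarefreeConvolution f g m * squarefreeConvolution f g n := by
  simp only [squarefreeConvolution, Nat.squarefree_mul h, (hf.mul hg).map_mul_of_coprime h,
    ite_zero_mul_ite_zero]

theorem squarefreeConvolution_prime (hf : f.IsMultiplicative) (hg : g.IsMultiplicative) {p : ℕ}
    (hp : p.Prime) : squarefreeConvolution f g p = f p + g p := by
  rw [squarefreeConvolution, if_pos hp.prime.squarefree, mul_apply,
    Nat.sum_divisorsAntidiagonal (fun i j => f i * g j), hp.sum_divisors, Nat.div_self hp.pos,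
    Nat.div_one, hf.map_one, hg.map_one, mul_one, one_mul]

theorem squarefreeConvolution_prime_pow {p e : ℕ} (hp : p.Prime) (he : 2 ≤ e) :
    squarefreeConvolution f g (p ^ e) = 0 :=
  if_neg fun h => hp.not_isUnit (h p (by rw [← sq]; exact pow_dvd_pow p he))

theorem tsum_squarefreeConvolution_prime_pow [TopologicalSpace R] (hf : f.IsMultiplicative)
    (hg : g.IsMultiplicative) {p : ℕ} (hp : p.Prime) :
    ∑' e, squarefreeConvolution f g (p ^ e) = 1 + (f p + g p) := by
  rw [tsum_eq_sum (s := Finset.range 2) fun e he =>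
      squarefreeConvolution_prime_pow hp (by simpa [Nat.succ_le_iff] using he),
    Finset.sum_range_succ, Finset.sum_range_one, pow_zero, pow_one,
    squarefreeConvolution_one hf hg, squarefreeConvolution_prime hf hg hp]

theorem tsum_fiber_squarefreePairTerm [TopologicalSpace R] (f g : ArithmeticFunction R) (n : ℕ) :
    ∑' x : (fun x : ℕ × ℕ => x.1 * x.2) ⁻¹' {n}, squarefreePairTerm f g x =
      squarefreeConvolution f g n := by
  by_cases hn : Squarefree n
  · have hset : (fun x : ℕ × ℕ => x.1 * x.2) ⁻¹' {n} = ↑n.divisorsAntidiagonal := by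
      ext x
      simp [hn.ne_zero]
    rw [squarefreeConvolution, if_pos hn, mul_apply, hset, Finset.tsum_subtype']
    refine Finset.sum_congr rfl fun x hx => if_pos ?_
    rwa [(Nat.mem_divisorsAntidiagonal.1 hx).1]
  · rw [squarefreeConvolution, if_neg hn]
    refine (tsum_congr fun x => if_neg ?_).trans tsum_zero
    rwa [show x.1.1 * x.1.2 = n from x.2]

end Algebra

variable {R : Type*} [NormedCommRing R] {f g : ArithmeticFunction R}

theorem summable_norm_squarefreePairTerm (hf : Summable fun n => ‖f n‖)
    (hg : Summable fun n => ‖g n‖) : Summable fun x => ‖squarefreePairTerm f g x‖ := by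
  refine .of_nonneg_of_le (fun _ => norm_nonneg _) (fun x => ?_) (hf.mul_norm hg)
  rw [squarefreePairTerm]
  split_ifs
  · exact le_rfl
  · exact norm_zero.trans_le (norm_nonneg _)

theorem summable_norm_squarefreeConvolution (hf : Summable fun n => ‖f n‖)
    (hg : Summable fun n => ‖g n‖) : Summable fun n => ‖squarefreeConvolution f g n‖ := by
  have h := summable_norm_squarefreePairTerm hf hg
  refine .of_nonneg_of_le (fun _ => norm_nonneg _) (fun n => ?_)
    (h.hasSum.tsum_fiberwise fun x : ℕ × ℕ => x.1 * x.2).summable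
  rw [← tsum_fiber_squarefreePairTerm]
  exact norm_tsum_le_tsum_norm (h.subtype _)

variable [CompleteSpace R]

theorem tsum_squarefreeConvolution (hf : Summable fun n => ‖f n‖) (hg : Summable fun n => ‖g n‖) :
    ∑' n, squarefreeConvolution f g n = ∑' x, squarefreePairTerm f g x := by
  simp only [← tsum_fiber_squarefreePairTerm]
  exact ((summable_norm_squarefreePairTerm hf hg).of_norm.hasSum.tsum_fiberwise
    fun x : ℕ × ℕ => x.1 * x.2).tsum_eq

theorem hasProd_one_add_add (hf : f.IsMultiplicative) (hg : g.IsMultiplicative)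
    (hf' : Summable fun n => ‖f n‖) (hg' : Summable fun n => ‖g n‖) :
    HasProd (fun p : Nat.Primes => 1 + (f p + g p)) (∑' x, squarefreePairTerm f g x) := by
  have h := EulerProduct.eulerProduct_hasProd (squarefreeConvolution_one hf hg)
    (squarefreeConvolution_mul hf hg) (summable_norm_squarefreeConvolution hf' hg')
    (if_neg not_squarefree_zero)
  simpa only [tsum_squarefreeConvolution hf' hg',
    fun p : Nat.Primes => tsum_squarefreeConvolution_prime_pow hf hg p.2] using h

end SquarefreePairs

section DirichletSeries

variable {N : ℕ} {s : ℂ}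

/-- The arithmetic function `n ↦ χ(n) n⁻ˢ`, set to `0` at `n = 0`. -/
noncomputable def dirichletTerm (χ : DirichletCharacter ℂ N) (s : ℂ) : ArithmeticFunction ℂ :=
  toArithmeticFunction fun n => χ n * (n : ℂ) ^ (-s)

theorem dirichletTerm_apply (χ : DirichletCharacter ℂ N) (s : ℂ) {n : ℕ} (hn : n ≠ 0) :
    dirichletTerm χ s n = χ n * (n : ℂ) ^ (-s) :=
  if_neg hn

theorem isMultiplicative_dirichletTerm (χ : DirichletCharacter ℂ N) (s : ℂ) :
    (dirichletTerm χ s).IsMultiplicative := by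
  refine ArithmeticFunction.IsMultiplicative.iff_ne_zero.2
    ⟨by simp [dirichletTerm_apply], fun hm hn _ => ?_⟩
  rw [dirichletTerm_apply _ _ (mul_ne_zero hm hn), dirichletTerm_apply _ _ hm,
    dirichletTerm_apply _ _ hn, Nat.cast_mul, map_mul, Nat.cast_mul,
    Complex.natCast_mul_natCast_cpow, mul_mul_mul_comm]

theorem summable_norm_dirichletTerm (χ : DirichletCharacter ℂ N) (hs : 1 < s.re) :
    Summable fun n => ‖dirichletTerm χ s n‖ := by
  refine .of_nonneg_of_le (fun _ => norm_nonneg _) (fun n => ?_) (summable_dirichletSummand χ hs)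
  obtain rfl | hn := eq_or_ne n 0
  · simp
  · exact (congrArg norm (dirichletTerm_apply χ s hn)).le

/-- The term `χ(a) χ²(b) (ab)⁻ˢ` of the Dirichlet series over the pairs `(a, b)` with `ab`
squarefree; thus `χ` is evaluated at the radicand `ab²`. -/
noncomputable def radicandTerm (χ : DirichletCharacter ℂ N) (s : ℂ) : ℕ × ℕ → ℂ :=
  squarefreePairTerm (dirichletTerm χ s) (dirichletTerm (χ ^ 2) s)

theorem radicandTerm_of_squarefree (χ : DirichletCharacter ℂ N) (s : ℂ) {a b : ℕ}
    (h : Squarefree (a * b)) :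
    radicandTerm χ s (a, b) = χ ((a * b ^ 2 : ℕ) : ZMod N) * ((a * b : ℕ) : ℂ) ^ (-s) := by
  rw [radicandTerm, squarefreePairTerm, if_pos h,
    dirichletTerm_apply _ _ (left_ne_zero_of_mul h.ne_zero),
    dirichletTerm_apply _ _ (right_ne_zero_of_mul h.ne_zero), MulChar.pow_apply' _ two_ne_zero,
    mul_mul_mul_comm, Nat.cast_mul a b, Complex.natCast_mul_natCast_cpow, Nat.cast_mul,
    Nat.cast_pow, map_mul, map_pow]

theorem radicandTerm_of_not_squarefree (χ : DirichletCharacter ℂ N) (s : ℂ) {a b : ℕ}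
    (h : ¬ Squarefree (a * b)) : radicandTerm χ s (a, b) = 0 :=
  if_neg h

theorem hasSum_radicandTerm (χ : DirichletCharacter ℂ N) (hs : 1 < s.re) :
    HasSum (radicandTerm χ s) (∑' x, radicandTerm χ s x) :=
  (summable_norm_squarefreePairTerm (summable_norm_dirichletTerm χ hs)
    (summable_norm_dirichletTerm _ hs)).of_norm.hasSum

theorem hasProd_radicandTerm (χ : DirichletCharacter ℂ N) (hs : 1 < s.re) :
    HasProd (fun p : Nat.Primes => 1 + (χ (p : ℕ) + χ (p : ℕ) ^ 2) * ((p : ℕ) : ℂ) ^ (-s))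
      (∑' x, radicandTerm χ s x) := by
  have h := hasProd_one_add_add (isMultiplicative_dirichletTerm χ s)
    (isMultiplicative_dirichletTerm (χ ^ 2) s) (summable_norm_dirichletTerm χ hs)
    (summable_norm_dirichletTerm (χ ^ 2) hs)
  simpa only [fun p : Nat.Primes => dirichletTerm_apply χ s p.2.ne_zero,
    fun p : Nat.Primes => dirichletTerm_apply (χ ^ 2) s p.2.ne_zero,
    MulChar.pow_apply' χ two_ne_zero, ← add_mul] using! h

end DirichletSeries

section CubicCharacter

/-- The exponent `i` modulo `3` of a unit `±2ⁱ` of `ZMod 9`, with junk value `2` at nonunits. -/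
def cubicIndex (x : ZMod 9) : ℕ :=
  if x = 1 ∨ x = -1 then 0 else if x = 2 ∨ x = -2 then 1 else 2

theorem isUnit_zmod_nine_iff : ∀ x : ZMod 9, IsUnit x ↔ 3 * x ≠ 0 := by decide

section

variable {R : Type*} [CommMonoidWithZero R] {z : R}

/-- The cubic character modulo `9` that sends `2` to a given solution of `z ^ 3 = 1`. -/
noncomputable def cubicChar (hz : z ^ 3 = 1) : MulChar (ZMod 9) R where
  toFun x := if 3 * x = 0 then 0 else z ^ cubicIndex x
  map_one' := by
    rw [if_neg (by decide)]
    exact pow_zero z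
  map_mul' x y := by
    have mul_eq_zero_iff : ∀ x y : ZMod 9, 3 * (x * y) = 0 ↔ 3 * x = 0 ∨ 3 * y = 0 := by decide
    have index_mul : ∀ x y : ZMod 9, ¬ 3 * x = 0 → ¬ 3 * y = 0 →
        cubicIndex (x * y) % 3 = (cubicIndex x + cubicIndex y) % 3 := by decide
    by_cases hx : 3 * x = 0
    · rw [if_pos hx, if_pos ((mul_eq_zero_iff _ _).2 (.inl hx)), zero_mul]
    by_cases hy : 3 * y = 0
    · rw [if_pos hy, if_pos ((mul_eq_zero_iff _ _).2 (.inr hy)), mul_zero]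
    rw [if_neg hx, if_neg hy, if_neg (by rw [mul_eq_zero_iff]; tauto), ← pow_add,
      pow_eq_pow_mod (cubicIndex (x * y)) hz, index_mul _ _ hx hy, ← pow_eq_pow_mod _ hz]
  map_nonunit' x hx := if_pos (not_not.1 (mt (isUnit_zmod_nine_iff x).2 hx))

theorem cubicChar_of_isUnit (hz : z ^ 3 = 1) {x : ZMod 9} (hx : IsUnit x) :
    cubicChar hz x = z ^ cubicIndex x :=
  if_neg ((isUnit_zmod_nine_iff x).1 hx)

theorem cubicChar_sq (hz : z ^ 3 = 1) (hz' : (z ^ 2) ^ 3 = 1) (x : ZMod 9) :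
    cubicChar hz' x = cubicChar hz x ^ 2 := by
  by_cases hx : IsUnit x
  · rw [cubicChar_of_isUnit hz hx, cubicChar_of_isUnit hz' hx, pow_right_comm]
  · rw [MulChar.map_nonunit _ hx, MulChar.map_nonunit _ hx, zero_pow two_ne_zero]

end

theorem one_add_cubicChar_add_sq {R : Type*} [CommRing R] {z : R} (hz : z ^ 2 + z + 1 = 0)
    (hz3 : z ^ 3 = 1) (x : ZMod 9) :
    (1 : MulChar (ZMod 9) R) x + cubicChar hz3 x + cubicChar hz3 x ^ 2 =
      if x = 1 ∨ x = -1 then 3 else 0 := by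
  by_cases hx : IsUnit x
  · rw [MulChar.one_apply hx, cubicChar_of_isUnit hz3 hx, cubicIndex]
    split_ifs
    · norm_num
    · linear_combination hz
    · linear_combination hz + z * hz3
  · have not_one_or : ¬ (x = 1 ∨ x = -1) := by
      rintro (rfl | rfl)
      exacts [hx isUnit_one, hx isUnit_one.neg]
    rw [MulChar.map_nonunit _ hx, MulChar.map_nonunit _ hx, if_neg not_one_or]
    ring

theorem one_apply_natCast_prime (R : Type*) [CommMonoidWithZero R] {p : ℕ} (hp : p.Prime) :
    (1 : MulChar (ZMod 9) R) p = if p = 3 then 0 else 1 := by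
  have isUnit_iff : IsUnit (p : ZMod 9) ↔ p ≠ 3 := by
    rw [ZMod.isUnit_iff_coprime, show 9 = 3 ^ 2 from rfl, Nat.coprime_pow_right_iff two_pos,
      Nat.coprime_primes hp Nat.prime_three]
  split_ifs with h
  · exact MulChar.map_nonunit _ (mt isUnit_iff.1 (not_not.2 h))
  · exact MulChar.one_apply (isUnit_iff.2 h)

end CubicCharacter

section EulerProducts

variable {s : ℂ}

/-- The set of primes `p ≠ 3`. -/
def primesNeThree : Set Nat.Primes := {p | (p : ℕ) ≠ 3}

/-- The set of primes `p ≡ ±1 (mod 9)`. -/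
def splitPrimes : Set Nat.Primes := {p | ((p : ℕ) : ZMod 9) = 1 ∨ ((p : ℕ) : ZMod 9) = -1}

theorem div_natCast_cpow (n : ℕ) (c : ℂ) : c / (n : ℂ) ^ s = c * (n : ℂ) ^ (-s) := by
  rw [Complex.cpow_neg, div_eq_mul_inv]

theorem multipliable_one_add_div_cpow (c : ℂ) (hs : 1 < s.re) (S : Set Nat.Primes) :
    Multipliable fun p : S => 1 + c / ((p : ℕ) : ℂ) ^ s := by
  refine multipliable_one_add_of_summable
    (Summable.subtype (f := fun p : Nat.Primes => ‖c / ((p : ℕ) : ℂ) ^ s‖) ?_ S)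
  refine ((Nat.Primes.summable_rpow.2 (neg_lt_neg hs)).mul_left ‖c‖).congr fun p => ?_
  rw [div_natCast_cpow, norm_mul, Complex.norm_natCast_cpow_of_pos p.2.pos, Complex.neg_re]

theorem multipliable_one_sub_div_cpow (c : ℂ) (hs : 1 < s.re) (S : Set Nat.Primes) :
    Multipliable fun p : S => 1 - c / ((p : ℕ) : ℂ) ^ s := by
  simpa only [neg_div, ← sub_eq_add_neg] using multipliable_one_add_div_cpow (-c) hs S

theorem hasProd_primesNeThree (hs : 1 < s.re) :
    HasProd (fun p : Nat.Primes => if (p : ℕ) = 3 then 1 else 1 + 2 / ((p : ℕ) : ℂ) ^ s)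
      (∏' p : primesNeThree, (1 + 2 / ((p : ℕ) : ℂ) ^ s)) := by
  rw [← hasProd_subtype_iff_of_mulSupport_subset (s := primesNeThree)]
  · convert (multipliable_one_add_div_cpow 2 hs primesNeThree).hasProd using 2 with p
    exact if_neg p.2
  · exact fun p hp hp3 => hp (if_pos hp3)

theorem hasProd_splitPrimes (hs : 1 < s.re) :
    HasProd (fun p : Nat.Primes =>
        if ((p : ℕ) : ZMod 9) = 1 ∨ ((p : ℕ) : ZMod 9) = -1 then 1 + 2 / ((p : ℕ) : ℂ) ^ s
        else 1 - 1 / ((p : ℕ) : ℂ) ^ s)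
      ((∏' p : splitPrimes, (1 + 2 / ((p : ℕ) : ℂ) ^ s)) *
        ∏' p : ↑splitPrimesᶜ, (1 - 1 / ((p : ℕ) : ℂ) ^ s)) := by
  refine HasProd.mul_compl (s := splitPrimes) ?_ ?_
  · convert (multipliable_one_add_div_cpow 2 hs splitPrimes).hasProd using 2 with p
    exact if_pos p.2
  · convert (multipliable_one_sub_div_cpow 1 hs splitPrimesᶜ).hasProd using 2 with p
    exact if_neg p.2

theorem hasProd_ite_prime_three (c : ℂ) :
    HasProd (fun p : Nat.Primes => if (p : ℕ) = 3 then c else 1) c := by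
  simpa only [Subtype.ext_iff] using! hasProd_ite_eq (⟨3, Nat.prime_three⟩ : Nat.Primes) c

theorem tsum_radicandTerm_one_level_nine (hs : 1 < s.re) :
    ∑' x, radicandTerm (1 : DirichletCharacter ℂ 9) s x =
      ∏' p : primesNeThree, (1 + 2 / ((p : ℕ) : ℂ) ^ s) := by
  refine (hasProd_radicandTerm 1 hs).unique ?_
  convert! hasProd_primesNeThree hs using 2 with p
  rw [one_apply_natCast_prime ℂ p.2, div_natCast_cpow]
  split_ifs <;> norm_num

theorem tsum_radicandTerm_one_level_one (hs : 1 < s.re) :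
    ∑' x, radicandTerm (1 : DirichletCharacter ℂ 1) s x =
      (1 + 2 / (3 : ℂ) ^ s) * ∏' p : primesNeThree, (1 + 2 / ((p : ℕ) : ℂ) ^ s) := by
  refine (hasProd_radicandTerm 1 hs).unique ?_
  convert! (hasProd_ite_prime_three (1 + 2 / (3 : ℂ) ^ s)).mul (hasProd_primesNeThree hs)
    using 2 with p
  rw [MulChar.one_apply (isUnit_of_subsingleton _), ← div_natCast_cpow]
  split_ifs with hp
  · rw [hp]
    norm_num
  · norm_num

theorem tsum_radicandTerm_cubicChar {z : ℂ} (hz : z ^ 2 + z + 1 = 0) (hz3 : z ^ 3 = 1)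
    (hs : 1 < s.re) :
    (1 - 1 / (3 : ℂ) ^ s) * ∑' x, radicandTerm (cubicChar hz3) s x =
      (∏' p : splitPrimes, (1 + 2 / ((p : ℕ) : ℂ) ^ s)) *
        ∏' p : ↑splitPrimesᶜ, (1 - 1 / ((p : ℕ) : ℂ) ^ s) := by
  refine ((hasProd_ite_prime_three _).mul (hasProd_radicandTerm _ hs)).unique ?_
  convert! hasProd_splitPrimes hs using 2 with p
  have add_sq_eq := one_add_cubicChar_add_sq hz hz3 (p : ℕ)
  rw [one_apply_natCast_prime ℂ p.2, add_assoc, ← eq_sub_iff_add_eq'] at add_sq_eq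
  rw [add_sq_eq, ← div_natCast_cpow]
  by_cases hp : (p : ℕ) = 3
  · have not_split : ¬ (((p : ℕ) : ZMod 9) = 1 ∨ ((p : ℕ) : ZMod 9) = -1) := by
      rw [hp]
      decide
    rw [if_neg not_split, if_neg not_split, if_pos hp, if_pos hp, hp]
    simp
  · simp only [if_neg hp]
    split_ifs <;> ring

end EulerProducts

section RadicandSeries

variable {s : ℂ}

theorem natCast_zmod_nine_eq_iff (n : ℕ) :
    ((n : ZMod 9) = 1 ∨ (n : ZMod 9) = -1) ↔ (n % 9 = 1 ∨ n % 9 = 8) := by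
  have eq_one_iff : (n : ZMod 9) = 1 ↔ n % 9 = 1 := by
    simpa using ZMod.natCast_eq_natCast_iff' n 1 9
  have eq_neg_one_iff : (n : ZMod 9) = -1 ↔ n % 9 = 8 := ZMod.natCast_eq_natCast_iff' n 8 9
  rw [eq_one_iff, eq_neg_one_iff]

theorem one_div_radicandConductor_cpow {z : ℂ} (hz : z ^ 2 + z + 1 = 0) (hz3 : z ^ 3 = 1)
    (hz3' : (z ^ 2) ^ 3 = 1) (a b : ℕ) :
    (if Squarefree (a * b) then 1 / (radicandConductor a b : ℂ) ^ s else 0) =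
      1 / (3 : ℂ) ^ s * radicandTerm (1 : DirichletCharacter ℂ 1) s (a, b) +
        (1 - 1 / (3 : ℂ) ^ s) / 3 * (radicandTerm (1 : DirichletCharacter ℂ 9) s (a, b) +
          radicandTerm (cubicChar hz3) s (a, b) + radicandTerm (cubicChar hz3') s (a, b)) := by
  split_ifs with hab
  · simp only [radicandTerm_of_squarefree _ s hab, ← add_mul, cubicChar_sq hz3 hz3',
      one_add_cubicChar_add_sq hz hz3, natCast_zmod_nine_eq_iff,
      MulChar.one_apply (isUnit_of_subsingleton _), radicandConductor]
    split_ifs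
    · rw [div_natCast_cpow]
      ring
    · rw [Nat.cast_mul 3, Complex.natCast_mul_natCast_cpow, Nat.cast_ofNat, ← div_div,
        div_natCast_cpow]
      ring
  · simp only [radicandTerm_of_not_squarefree _ s hab, add_zero, mul_zero]

theorem hasSum_squarefree_pairs (hs : 1 < s.re) :
    HasSum (fun x : ℕ × ℕ =>
        if Squarefree (x.1 * x.2) then 1 / (radicandConductor x.1 x.2 : ℂ) ^ s else 0)
      (1 / 3 * (1 + 2 / (3 : ℂ) ^ s + 6 / (3 : ℂ) ^ (2 * s)) *
          (∏' p : primesNeThree, (1 + 2 / ((p : ℕ) : ℂ) ^ s)) +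
        2 / 3 * (∏' p : splitPrimes, (1 + 2 / ((p : ℕ) : ℂ) ^ s)) *
          ∏' p : ↑splitPrimesᶜ, (1 - 1 / ((p : ℕ) : ℂ) ^ s)) := by
  obtain ⟨z, hz⟩ := exists_sq_add_add_one_eq_zero_of_isAlgClosed ℂ
  have hz' := sq_sq_add_sq_add_one_eq_zero hz
  have hz3 : z ^ 3 = 1 := by linear_combination (z - 1) * hz
  have hz3' : (z ^ 2) ^ 3 = 1 := by linear_combination (z ^ 2 - 1) * hz'
  have sum_eq := ((hasSum_radicandTerm (1 : DirichletCharacter ℂ 1) hs).mul_left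
    (1 / (3 : ℂ) ^ s)).add ((((hasSum_radicandTerm (1 : DirichletCharacter ℂ 9) hs).add
      (hasSum_radicandTerm (cubicChar hz3) hs)).add
      (hasSum_radicandTerm (cubicChar hz3') hs)).mul_left ((1 - 1 / (3 : ℂ) ^ s) / 3))
  simp only [← one_div_radicandConductor_cpow hz hz3 hz3'] at sum_eq
  convert! sum_eq using 1
  rw [tsum_radicandTerm_one_level_one hs, tsum_radicandTerm_one_level_nine hs, mul_comm 2 s,
    Complex.cpow_mul_ofNat]
  linear_combination (-1 / 3) * tsum_radicandTerm_cubicChar hz hz3 hs -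
    1 / 3 * tsum_radicandTerm_cubicChar hz' hz3' hs

/-- The set of pairs `(a, b)` that parametrize pure cubic fields. -/
def radicands : Set (ℕ × ℕ) := {x | IsRadicand x.1 x.2}

theorem hasSum_radicands (hs : 1 < s.re) :
    HasSum (fun x : radicands => 1 / (radicandConductor x.1.1 x.1.2 : ℂ) ^ s)
      (2 * (-1 / 2 +
          1 / 6 * (1 + 2 / (3 : ℂ) ^ s + 6 / (3 : ℂ) ^ (2 * s)) *
            (∏' p : primesNeThree, (1 + 2 / ((p : ℕ) : ℂ) ^ s)) +
          1 / 3 *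
            (∏' p : splitPrimes, (1 + 2 / ((p : ℕ) : ℂ) ^ s)) *
            (∏' p : ↑splitPrimesᶜ, (1 - 1 / ((p : ℕ) : ℂ) ^ s)))) := by
  have sum_sub_one := (hasSum_squarefree_pairs hs).sub (hasSum_ite_eq ((1, 1) : ℕ × ℕ) (1 : ℂ))
  rw [← hasSum_subtype_iff_of_support_subset (s := radicands)] at sum_sub_one
  · convert! sum_sub_one using 1
    · funext ⟨x, hx⟩
      have hne : x ≠ (1, 1) := fun h => hx.2 (Prod.ext_iff.1 h)
      rw [Function.comp_apply, if_pos hx.1, if_neg hne, sub_zero]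
    · ring
  · intro x hx
    by_contra hn
    refine hx ?_
    by_cases h11 : x = (1, 1)
    · simp [h11, radicandConductor]
    · have hsq : ¬ Squarefree (x.1 * x.2) := fun h => hn ⟨h, fun h' => h11 (Prod.ext h'.1 h'.2)⟩
      simp only [if_neg hsq, if_neg h11, sub_zero]

end RadicandSeries

section IsomorphismClasses

theorem exists_pureCubicField {a b : ℕ} (h : IsRadicand a b) :
    ∃ (K : PureCubicField) (η : K.1), η ^ 3 = a * b ^ 2 := by
  obtain ⟨θ, hθ⟩ := IsAlgClosed.exists_pow_nat_eq (a * b ^ 2 : AlgebraicClosure ℚ) three_pos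
  let K := IntermediateField.adjoin ℚ {θ}
  let η : K := IntermediateField.AdjoinSimple.gen ℚ θ
  have hη : η ^ 3 = a * b ^ 2 := Subtype.ext (by simpa [η] using hθ)
  have hd : Module.finrank ℚ K = 3 :=
    finrank_adjoin_of_pow_three_eq h.cube_ne (hθ.trans algebraMap_radicand.symm)
  exact ⟨⟨K, isPureCubic_of_isRadicand hd h hη⟩, η, hη⟩

/-- The pure cubic field chosen inside the algebraic closure for a radicand `a * b ^ 2`. -/
noncomputable def radicandField (x : radicands) : PureCubicField :=
  (exists_pureCubicField x.2).choose

theorem exists_radicandField_pow_three_eq (x : radicands) :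
    ∃ η : (radicandField x).1, η ^ 3 = x.1.1 * x.1.2 ^ 2 :=
  (exists_pureCubicField x.2).choose_spec

/-- The isomorphism class of the fields generated by a cube root of `a * b ^ 2`. -/
noncomputable def radicandClass (x : radicands) : PureCubicClass :=
  ⟦radicandField x⟧

theorem radicandClass_eq_iff (x : radicands) (K : PureCubicField) :
    radicandClass x = ⟦K⟧ ↔ ∃ η : K.1, η ^ 3 = x.1.1 * x.1.2 ^ 2 := by
  obtain ⟨η, hη⟩ := exists_radicandField_pow_three_eq x
  refine Quotient.eq.trans ⟨?_, ?_⟩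
  · rintro ⟨e⟩
    exact ⟨e η, by rw [← map_pow, hη]; simp⟩
  · rintro ⟨η', hη'⟩
    exact nonempty_algEquiv_of_pow_three_eq (radicandField x).2.1 K.2.1 x.2.cube_ne
      (hη.trans algebraMap_radicand.symm) (hη'.trans algebraMap_radicand.symm)

theorem classConductor_radicandClass (x : radicands) :
    classConductor (radicandClass x) = radicandConductor x.1.1 x.1.2 := by
  obtain ⟨η, hη⟩ := exists_radicandField_pow_three_eq x
  have hd : Module.finrank ℚ (radicandField x).1 = 3 := (radicandField x).2.1
  have := Module.finite_of_finrank_pos (hd.symm ▸ three_pos)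
  exact cubicConductor_eq hd x.2 hη

theorem isCubicConductor_cubicConductor (K : PureCubicField) :
    IsCubicConductor K.1 (cubicConductor K.1) := by
  obtain ⟨a, b, hab, η, hη⟩ := exists_isRadicand_of_isPureCubic K.2
  have := Module.finite_of_finrank_pos (K.2.1.symm ▸ three_pos)
  exact (isCubicConductor_iff K.2.1 hab hη _).2 (cubicConductor_eq K.2.1 hab hη)

theorem card_radicandClass_fiber (C : PureCubicClass) :
    Nat.card {x : radicands // radicandClass x = C} = 2 := by
  induction C using Quotient.inductionOn with | _ K
  obtain ⟨a, b, hab, η, hη⟩ := exists_isRadicand_of_isPureCubic K.2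
  obtain ⟨η', hη'⟩ := exists_pow_three_eq_symm hab hη
  rw [← Set.coe_ofPred, Nat.card_coe_set_eq, Set.ncard_eq_two]
  refine ⟨⟨(a, b), hab⟩, ⟨(b, a), hab.symm⟩, fun h => hab.ne (congrArg (·.1.1) h), ?_⟩
  ext x
  rw [Set.mem_insert_iff, Set.mem_singleton_iff]
  refine (radicandClass_eq_iff x K).trans ⟨?_, ?_⟩
  · rintro ⟨ξ, hξ⟩
    refine (eq_or_eq_symm_of_pow_three_eq K.2.1 hab x.2 hη hξ).imp ?_ ?_ <;>
      exact fun h => Subtype.ext (Prod.ext h.1.symm h.2.symm)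
  · rintro (rfl | rfl)
    exacts [⟨η, hη⟩, ⟨η', hη'⟩]

theorem hasSum_of_comp_of_card_fiber {α β 𝕜 : Type*} [Field 𝕜] [CharZero 𝕜] [TopologicalSpace 𝕜]
    [IsTopologicalRing 𝕜] [RegularSpace 𝕜] {φ : α → β} {n : ℕ} (hn : n ≠ 0)
    (hφ : ∀ c, Nat.card {x // φ x = c} = n) {g : β → 𝕜} {t : 𝕜} (h : HasSum (g ∘ φ) (n * t)) :
    HasSum g t := by
  rw [← (Equiv.sigmaFiberEquiv φ).hasSum_iff] at h
  have hasSum_fiber (c : β) : HasSum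
      (fun x : {x // φ x = c} => ((g ∘ φ) ∘ Equiv.sigmaFiberEquiv φ) ⟨c, x⟩) (n * g c) := by
    have : Finite {x // φ x = c} := Nat.finite_of_card_ne_zero (by rwa [hφ])
    have := Fintype.ofFinite {x // φ x = c}
    have sum_const := hasSum_fintype fun _ : {x // φ x = c} => g c
    rw [Finset.sum_const, Finset.card_univ, ← Nat.card_eq_fintype_card, hφ,
      nsmul_eq_mul] at sum_const
    exact sum_const.congr_fun fun x => congrArg g x.2
  simpa [hn] using (h.sigma hasSum_fiber).mul_left (n : 𝕜)⁻¹

theorem hasSum_classConductor {s t : ℂ}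
    (h : HasSum (fun x : radicands => 1 / (radicandConductor x.1.1 x.1.2 : ℂ) ^ s) (2 * t)) :
    HasSum (fun C : PureCubicClass => 1 / (classConductor C : ℂ) ^ s) t := by
  refine hasSum_of_comp_of_card_fiber (φ := radicandClass) two_ne_zero card_radicandClass_fiber ?_
  simpa only [Function.comp_def, classConductor_radicandClass, Nat.cast_ofNat] using h

end IsomorphismClasses

end PureCubic

theorem proposition7p3 :
    (∀ K : PureCubic.PureCubicField,
      PureCubic.IsCubicConductor K.1 (PureCubic.cubicConductor K.1)) ∧
    ∀ s : ℂ, 1 < s.re →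
      Multipliable (fun p : {p : Nat.Primes // (p : ℕ) ≠ 3} =>
        1 + 2 / ((p : ℕ) : ℂ) ^ s) ∧
      Multipliable (fun p : {p : Nat.Primes // ((p : ℕ) : ZMod 9) = 1 ∨ ((p : ℕ) : ZMod 9) = -1} =>
        1 + 2 / ((p : ℕ) : ℂ) ^ s) ∧
      Multipliable
        (fun p : {p : Nat.Primes // ¬(((p : ℕ) : ZMod 9) = 1 ∨ ((p : ℕ) : ZMod 9) = -1)} =>
          1 - 1 / ((p : ℕ) : ℂ) ^ s) ∧
      HasSum (fun K : PureCubic.PureCubicClass => 1 / (PureCubic.classConductor K : ℂ) ^ s)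
        (-1 / 2 +
          1 / 6 * (1 + 2 / (3 : ℂ) ^ s + 6 / (3 : ℂ) ^ (2 * s)) *
            (∏' p : {p : Nat.Primes // (p : ℕ) ≠ 3}, (1 + 2 / ((p : ℕ) : ℂ) ^ s)) +
          1 / 3 *
            (∏' p : {p : Nat.Primes // ((p : ℕ) : ZMod 9) = 1 ∨ ((p : ℕ) : ZMod 9) = -1},
              (1 + 2 / ((p : ℕ) : ℂ) ^ s)) *
            (∏' p : {p : Nat.Primes // ¬(((p : ℕ) : ZMod 9) = 1 ∨ ((p : ℕ) : ZMod 9) = -1)},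
              (1 - 1 / ((p : ℕ) : ℂ) ^ s))) := by
  refine ⟨PureCubic.isCubicConductor_cubicConductor, fun s hs => ⟨?_, ?_, ?_, ?_⟩⟩
  · exact PureCubic.multipliable_one_add_div_cpow 2 hs PureCubic.primesNeThree
  · exact PureCubic.multipliable_one_add_div_cpow 2 hs PureCubic.splitPrimes
  · exact PureCubic.multipliable_one_sub_div_cpow 1 hs PureCubic.splitPrimesᶜ
  · exact PureCubic.hasSum_classConductor (PureCubic.hasSum_radicands hs)
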